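/- **Corollary 2.** Let $T_n=T_n(v)\in\mathbb{Q}[b_1,b_2][v]$, $n\ge 0$, be the Umemura polynomials attached to the Painlevé VI equation, that is, the sequence with $T_0=T_1=1$ and, for $n\ge1$, $$T_{n-1}T_{n+1}=\Big\{\tfrac14\big(-2b_1^2-2b_2^2+(b_1^2-b_2^2)v\big)+\big(n-\tfrac12\big)^2\Big\}T_n^2+\tfrac14(v^2-4)^2\big\{T_nT_n''-(T_n')^2\big\}+\tfrac14(v^2-4)\,v\,T_nT_n',\qquad {}'=\tfrac{d}{dv}.$$ For $a,b\in\mathbb{C}$ put $\bar a_k=a+(k-1)^2$, $\bar b_k=b+(k-1)^2$, $a_{2k}=\bar a_2\bar a_4\cdots\bar a_{2k}$, $b_{2k}=\bar b_2\bar b_4\cdots\bar b_{2k}$. For an integer $m\ge 0$ let $[0;m]=\{2,4,\dots,2m\}$, and for complex $z,w,b_1,b_2$ set $$U_m(b_1,b_2)=\sum_{I\subset[0;m]}\ \prod_{i\in I,\;j\in[0;m]\setminus I}\left|\frac{i+j}{i-j}\right|\,(-1)^{\sum_{i\in I} i/2}\,\prod_{i\in I}a_i z^i\prod_{j\in[0;m]\setminus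 I}b_j w^j,\qquad a=-4b_1^2,\quad b=-4b_2^2,$$ and $U_{-1}=1$. Assume throughout that $w^2-z^2=1$ (as for $z=\frac12(e^x+e^{-x}-2)^{1/2}$, $w=\frac12(e^x+e^{-x}+2)^{1/2}$ with matching branches). The sequence $(T_n)$ exists and is unique, and the $U_m$ are the Umemura polynomials: $U_{n-1}(b_1,b_2)=2^{n(n-1)}T_n(v)$ with $v=2+4z^2$, for all $n\ge0$. For all integers $m\ge0$ and all $b_1,b_2\in\mathbb{C}$, with $a=-4b_1^2$ and $b=-4b_2^2$, the following relations hold: $$U_{m-1}(b_1,b_2)\,U_{m+1}(b_1,b_2)-4w^2(b_1^2-b_2^2)\,U_m(b_1-1,b_2)\,U_m(b_1+1,b_2)=\bar a_{2m+2}\,U_m(b_1,b_2)^2,$$ $$U_{m-1}(b_1,b_2)\,U_{m+1}(b_1,b_2)-4z^2(b_1^2-b_2^2)\,U_m(b_1,b_2-1)\,U_m(b_1,b_2+1)=\bar b_{2m+2}\,U_m(b_1,b_2)^2,$$ $$U_{m-1}(b_1,b_2)\,U_{m+1}(b_1,b_2)-\bar b_{2m+2}\,w^2\,U_m(b_1-1,b_2)\,U_m(b_1+1,b_2)+\bar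 a_{2m+2}\,z^2\,U_m(b_1,b_2-1)\,U_m(b_1,b_2+1)=0.$$ -/

import Mathlib

noncomputable section

/-- `ā_k = a + (k - 1)^2`. -/
def abar (a : ℂ) (k : ℤ) : ℂ := a + ((k : ℂ) - 1) ^ 2

/-- `a_{2k} = ā_2 ā_4 ⋯ ā_{2k}`. -/
def aEven (a : ℂ) (k : ℕ) : ℂ := ∏ s ∈ Finset.Icc 1 k, abar a (2 * s)

/-- The set `{1, …, m}`, empty for `m ≤ 0`. Its element `i` stands for the element `2 i` of the
index set `[0; m] = {2, 4, …, 2m}`. -/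
def halfIndex (m : ℤ) : Finset ℕ := Finset.Icc 1 m.toNat

/-- `d_{0,m}(I) = ∏_{i ∈ I, j ∉ I} |(i + j) / (i - j)|`; the quotient does not change when
all indices are halved. -/
def dNum (m : ℤ) (I : Finset ℕ) : ℚ :=
  ∏ i ∈ I, ∏ j ∈ halfIndex m \ I, |((i : ℚ) + j) / ((i : ℚ) - j)|

/-- The polynomial `U_{0,m}^{(0)}(z, w; a, b)`, the sum over `I ⊆ [0; m]` of
`d_{0,m}(I) (-1)^{c(I)} a_I b_{Iᶜ} z^{|I|} w^{|Iᶜ|}`. It is `1` for `m = -1` and `m = 0`. -/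
def genUmemura (m : ℤ) (z w a b : ℂ) : ℂ :=
  ∑ I ∈ (halfIndex m).powerset,
    (dNum m I : ℂ) * (-1) ^ (∑ i ∈ I, i) *
      ((∏ i ∈ I, aEven a i) * (∏ j ∈ halfIndex m \ I, aEven b j)) *
      (z ^ (∑ i ∈ I, 2 * i) * w ^ (∑ j ∈ halfIndex m \ I, 2 * j))

/-- `U_m(b₁, b₂) = U_{0,m}^{(0)}(z, w; -4 b₁², -4 b₂²)`. -/
def umemuraU (m : ℤ) (b₁ b₂ z w : ℂ) : ℂ :=
  genUmemura m z w (-4 * b₁ ^ 2) (-4 * b₂ ^ 2)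

/-- Polynomials in `v` whose coefficients are rational polynomials in the indeterminates
`b₁ = X 0` and `b₂ = X 1`. -/
abbrev ParamPoly : Type := Polynomial (MvPolynomial (Fin 2) ℚ)

/-- The indeterminate `b₁`. -/
def ParamPoly.b₁ : ParamPoly := Polynomial.C (MvPolynomial.X 0)

/-- The indeterminate `b₂`. -/
def ParamPoly.b₂ : ParamPoly := Polynomial.C (MvPolynomial.X 1)

/-- The value of a polynomial in `b₁, b₂, v` at complex numbers. -/
def ParamPoly.value (T : ParamPoly) (b₁ b₂ v : ℂ) : ℂ :=
  Polynomial.eval₂ (MvPolynomial.aeval (R := ℚ) ![b₁, b₂]).toRingHom v T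

open ParamPoly in
/-- The Toda recurrence that defines Umemura's polynomials `T_n(v)`, with `T_0 = T_1 = 1`. -/
structure IsUmemuraSequence (T : ℕ → ParamPoly) : Prop where
  zero : T 0 = 1
  one : T 1 = 1
  toda : ∀ n : ℕ, 1 ≤ n →
    T (n - 1) * T (n + 1) =
      ((1 / 4 : ℚ) • (-2 * b₁ ^ 2 - 2 * b₂ ^ 2 + (b₁ ^ 2 - b₂ ^ 2) * Polynomial.X)
          + (((n : ℚ) - 1 / 2) ^ 2) • (1 : ParamPoly)) * T n ^ 2
        + (1 / 4 : ℚ) • ((Polynomial.X ^ 2 - 4) ^ 2 *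
            (T n * Polynomial.derivative (Polynomial.derivative (T n))
              - Polynomial.derivative (T n) ^ 2))
        + (1 / 4 : ℚ) • ((Polynomial.X ^ 2 - 4) * Polynomial.X *
            (T n * Polynomial.derivative (T n)))

end

noncomputable section

open Finset Polynomial

/-! Write Z = z², W = w², and let τ(x) be `tauAt` for the weights of U_m: the defining sum with an
extra factor x + i for each i ∈ I and x - j for each j outside I. At x = a only the subsets
containing a survive, at x = -a only those avoiding a, and both sums collapse to the same sum over
the other indices. This gives the reflection relations `tauAt_reflection`. Special values of τ
recover, up to explicit factors, every polynomial in the theorem: x = 1/2 ± b₁ shifts b₁ by ±1, x =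
-1/2 ± b₂ shifts b₂ by ∓1, x = ±m gives U_{m-1}, and x = ±(m+1) together give U_{m+1}.

The expression W(u² - b₂²)τ(1/2+u)τ(1/2-u) - Z(u² - b₁²)τ(-1/2+u)τ(-1/2-u) is an even polynomial in
u of degree at most 2m + 2. The reflection relations at i and i - 1 make it vanish at u = ±(i - 1/2)
for 1 ≤ i ≤ m. Hence it is ∏((i - 1/2)² - u²) times an affine function of u², which its top
coefficients determine (`tauAt_pencil`). The values of that function at u = b₁, b₂ and m + 1/2 are
the three bilinear products, up to constants, and its slope is (W - Z)U_m². Differences of values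
give the first two relations; eliminating U_m² gives 4(b₁² - b₂²) times the third.

The constant term of the affine function contains the first two moments of 2∑I - ∑S. In the variable
v the operator (v² - 4) d/dv raises the order of these moments
(`sq_sub_four_mul_derivative_moment`), so the value at u = m + 1/2 becomes the Toda recurrence.
Uniqueness of the sequence follows by cancelling nonzero terms. The cancellations are made with b₁,
b₂, v indeterminate; evaluation then yields the bilinear relations and the identification with T_n
for all complex parameters. -/

/-- The signed interaction weight `(-1)^(∑ I) ∏_{i ∈ I, j ∈ S \ I} |(i + j) / (i - j)|`. -/
def crossWeight (S I : Finset ℕ) : ℚ :=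
  (∏ i ∈ I, ∏ j ∈ S \ I, |((i : ℚ) + j) / ((i : ℚ) - j)|) * (-1) ^ (∑ i ∈ I, i)

/-! ### Signed subset sums and their reflection relations. -/

section Tau

variable {K L : Type*} [CommRing K] [Algebra ℚ K] [CommRing L] [Algebra ℚ L]

/-- The sum over `I ⊆ S` of `∏_{i ∈ I} α i * ∏_{j ∈ S \ I} β j` with the weights `crossWeight`. -/
def tau (S : Finset ℕ) (α β : ℕ → K) : K :=
  ∑ I ∈ S.powerset, algebraMap ℚ K (crossWeight S I) * ((∏ i ∈ I, α i) * ∏ j ∈ S \ I, β j)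

theorem tau_empty (α β : ℕ → K) : tau ∅ α β = 1 := by
  simp [tau, crossWeight]

theorem tau_congr {S : Finset ℕ} {α β α' β' : ℕ → K} (hα : ∀ i ∈ S, α i = α' i)
    (hβ : ∀ i ∈ S, β i = β' i) : tau S α β = tau S α' β' := by
  refine sum_congr rfl fun I hI => ?_
  rw [prod_congr rfl fun i hi => hα i (mem_powerset.1 hI hi),
    prod_congr rfl fun j hj => hβ j (mem_sdiff.1 hj).1]

theorem map_tau (f : K →+* L) (S : Finset ℕ) (α β : ℕ → K) :
    f (tau S α β) = tau S (fun i => f (α i)) (fun i => f (β i)) := by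
  simp [tau, map_sum, map_mul, map_prod, RingHom.map_rat_algebraMap]

/-- Each index of S lies in exactly one of I and S \ I, so a factor common to both weights leaves
the sum. -/
theorem tau_mul (S : Finset ℕ) (f α β : ℕ → K) :
    tau S (fun i => f i * α i) (fun i => f i * β i) = (∏ i ∈ S, f i) * tau S α β := by
  rw [tau, tau, mul_sum]
  refine sum_congr rfl fun I hI => ?_
  rw [prod_mul_distrib, prod_mul_distrib, ← prod_sdiff (mem_powerset.1 hI)]
  ring

theorem tau_of_left_eq_zero {S : Finset ℕ} {α β : ℕ → K} (hα : ∀ i ∈ S, α i = 0) :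
    tau S α β = ∏ j ∈ S, β j := by
  rw [tau, sum_eq_single ∅]
  · simp [crossWeight]
  · intro I hI hne
    obtain ⟨i, hi⟩ := nonempty_iff_ne_empty.2 hne
    rw [prod_eq_zero hi (hα i (mem_powerset.1 hI hi)), zero_mul, mul_zero]
  · simp

theorem crossWeight_insert_insert {S I : Finset ℕ} {a : ℕ} (ha : a ∉ S) (hI : I ⊆ S) :
    crossWeight (insert a S) (insert a I) =
      (-1) ^ a * crossWeight S I * ∏ j ∈ S \ I, |((a : ℚ) + j) / ((a : ℚ) - j)| := by
  have haI : a ∉ I := fun h => ha (hI h)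
  have hs : insert a S \ insert a I = S \ I := by
    ext x
    simp only [mem_sdiff, mem_insert]
    grind
  rw [crossWeight, crossWeight, hs, prod_insert haI, sum_insert haI, pow_add]
  ring

theorem crossWeight_insert {S I : Finset ℕ} {a : ℕ} (ha : a ∉ S) (hI : I ⊆ S) :
    crossWeight (insert a S) I =
      crossWeight S I * ∏ i ∈ I, |((i : ℚ) + a) / ((i : ℚ) - a)| := by
  have haI : a ∉ I := fun h => ha (hI h)
  have hs : insert a S \ I = insert a (S \ I) := insert_sdiff_of_notMem _ haI
  have haS : a ∉ S \ I := fun h => ha (mem_sdiff.1 h).1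
  rw [crossWeight, crossWeight, hs]
  simp only [prod_insert haS, prod_mul_distrib]
  ring

theorem tau_insert {S : Finset ℕ} {a : ℕ} (ha : a ∉ S) (α β : ℕ → K) :
    tau (insert a S) α β =
      β a * tau S (fun i => algebraMap ℚ K |((i : ℚ) + a) / ((i : ℚ) - a)| * α i) β +
      (-1) ^ a * α a *
        tau S α (fun j => algebraMap ℚ K |((a : ℚ) + j) / ((a : ℚ) - j)| * β j) := by
  rw [tau, sum_powerset_insert ha, tau, tau, mul_sum, mul_sum]
  congr 1
  · refine sum_congr rfl fun I hI => ?_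
    have hI := mem_powerset.1 hI
    have haI : a ∉ I := fun h => ha (hI h)
    have haS : a ∉ S \ I := fun h => ha (mem_sdiff.1 h).1
    rw [crossWeight_insert ha hI, insert_sdiff_of_notMem _ haI, prod_insert haS,
      prod_mul_distrib, map_mul, map_prod]
    ring
  · refine sum_congr rfl fun I hI => ?_
    have hI := mem_powerset.1 hI
    have haI : a ∉ I := fun h => ha (hI h)
    have hs : insert a S \ insert a I = S \ I := by
      ext x
      simp only [mem_sdiff, mem_insert]
      grind
    rw [crossWeight_insert_insert ha hI, hs, prod_insert haI,
      prod_mul_distrib, map_mul, map_mul, map_prod, map_pow, map_neg, map_one]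
    ring

/-- The polynomial `x ↦ tau S (α i * (x + i)) (β j * (x - j))`. -/
def tauAt (S : Finset ℕ) (α β : ℕ → K) (x : K) : K :=
  tau S (fun i => α i * (x + i)) (fun j => β j * (x - j))

/-- The factor x - a kills the subsets that omit a. In the others the interaction with a turns a - j
into ±(a + j), so the a + k on I and the a + j off I agree up to sign. -/
theorem tauAt_self {S : Finset ℕ} {a : ℕ} (ha : a ∉ S) (α β : ℕ → K) :
    tauAt (insert a S) α β a = (-1) ^ a * (2 * a) * α a *
      tau S (fun k => α k * (a + k))
        (fun j => algebraMap ℚ K (SignType.sign ((a : ℚ) - j) : ℚ) * (β j * (a + j))) := by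
  rw [tauAt, tau_insert ha]
  rw [tau_congr (S := S) (α := fun i => α i * ((a : K) + i)) (α' := fun k => α k * ((a : K) + k))
    (β' := fun j => algebraMap ℚ K (SignType.sign ((a : ℚ) - j) : ℚ) * (β j * (a + j)))
    (fun i hi => rfl)]
  · ring
  · intro j hj
    have hne : (a : ℚ) - j ≠ 0 := by
      rw [sub_ne_zero]
      rintro h
      exact ha (by rwa [Nat.cast_inj.1 h])
    have key : |((a : ℚ) + j) / (a - j)| * (a - j) = SignType.sign ((a : ℚ) - j) * (a + j) := by
      rw [abs_div, abs_of_nonneg (by positivity : (0 : ℚ) ≤ a + j)]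
      have h2 : SignType.sign ((a : ℚ) - j) * |(a : ℚ) - j| = (a : ℚ) - j := sign_mul_abs _
      have h3 : |(a : ℚ) - j| ≠ 0 := abs_ne_zero.2 hne
      field_simp
      linear_combination (-1 : ℚ) * (a + j) * h2
    have := congrArg (algebraMap ℚ K) key
    simp only [map_mul, map_sub, map_add, map_natCast] at this
    linear_combination β j * this

/-- Now x + a kills the subsets containing a. The remaining sum is the one in `tauAt_self` up to a
product of signs, which is what makes the two values comparable. -/
theorem tauAt_neg_self {S : Finset ℕ} {a : ℕ} (ha : a ∉ S) (α β : ℕ → K) :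
    tauAt (insert a S) α β (-a) = -(2 * a) * β a * (∏ k ∈ S, algebraMap ℚ K
        (SignType.sign ((k : ℚ) - a) : ℚ)) *
      tau S (fun k => α k * (a + k))
        (fun j => algebraMap ℚ K (SignType.sign ((a : ℚ) - j) : ℚ) * (β j * (a + j))) := by
  rw [tauAt, tau_insert ha, mul_assoc _ (∏ k ∈ S, _) (tau _ _ _), ← tau_mul]
  rw [tau_congr (S := S) (β := fun j => β j * (-(a : K) - j))
    (α' := fun k => algebraMap ℚ K (SignType.sign ((k : ℚ) - a) : ℚ) * (α k * (a + k)))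
    (β' := fun k => algebraMap ℚ K (SignType.sign ((k : ℚ) - a) : ℚ) *
        (algebraMap ℚ K (SignType.sign ((a : ℚ) - k) : ℚ) * (β k * (a + k))))]
  · ring
  · intro j hj
    have hne : (j : ℚ) - a ≠ 0 := by
      rw [sub_ne_zero]
      rintro h
      exact ha (by rwa [← Nat.cast_inj.1 h])
    have key : |((j : ℚ) + a) / (j - a)| * (j - a) = SignType.sign ((j : ℚ) - a) * (a + j) := by
      rw [abs_div, abs_of_nonneg (by positivity : (0 : ℚ) ≤ j + a)]
      have h2 : SignType.sign ((j : ℚ) - a) * |(j : ℚ) - a| = (j : ℚ) - a := sign_mul_abs _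
      have h3 : |(j : ℚ) - a| ≠ 0 := abs_ne_zero.2 hne
      field_simp
      linear_combination (-1 : ℚ) * (a + j) * h2
    have := congrArg (algebraMap ℚ K) key
    simp only [map_mul, map_sub, map_add, map_natCast] at this
    linear_combination α j * this
  · intro j hj
    have hne : j ≠ a := by
      rintro rfl
      exact ha hj
    -- Writing -1 as a product of two opposite signs exposes the common factor sign(k - a) on both
    -- sides, so that `tau_mul` can extract it.
    have key : (SignType.sign ((j : ℚ) - a) : ℚ) * (SignType.sign ((a : ℚ) - j) : ℚ) = -1 := by
      rcases lt_or_gt_of_ne hne with h | h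
      · rw [sign_neg (sub_neg.2 (Nat.cast_lt.2 h)), sign_pos (sub_pos.2 (Nat.cast_lt.2 h))]
        simp
      · rw [sign_pos (sub_pos.2 (Nat.cast_lt.2 h)), sign_neg (sub_neg.2 (Nat.cast_lt.2 h))]
        simp
    have := congrArg (algebraMap ℚ K) key
    simp only [map_mul, map_neg, map_one] at this
    linear_combination (-β j * (a + j)) * this

/-- Only the a - 1 indices below a contribute. This sign matches the (-1)^a carried by the subsets
containing a. -/
theorem prod_sign_sub_erase {m a : ℕ} (ha : a ∈ Icc 1 m) :
    ∏ k ∈ (Icc 1 m).erase a, algebraMap ℚ K (SignType.sign ((k : ℚ) - a) : ℚ) =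
      (-1) ^ (a - 1) := by
  have hsplit : (Icc 1 m).erase a = Ico 1 a ∪ Ioc a m := by
    ext x
    simp only [mem_erase, mem_Icc, mem_union, mem_Ico, mem_Ioc] at ha ⊢
    omega
  have hdisj : Disjoint (Ico 1 a) (Ioc a m) := by
    rw [disjoint_left]
    intro x h1 h2
    simp only [mem_Ico, mem_Ioc] at h1 h2
    omega
  rw [hsplit, prod_union hdisj, prod_eq_one (s := Ioc a m), mul_one,
    prod_congr rfl (g := fun _ => (-1 : K)), prod_const, Nat.card_Ico]
  · intro x hx
    rw [sign_neg (sub_neg.2 (Nat.cast_lt.2 (mem_Ico.1 hx).2))]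
    simp
  · intro x hx
    rw [sign_pos (sub_pos.2 (Nat.cast_lt.2 (mem_Ioc.1 hx).1))]
    simp

/-- The reflection relations satisfied by `tauAt` at the points of `{1, …, m}`. -/
theorem tauAt_reflection (α β : ℕ → K) {m a : ℕ} (ha : a ∈ Icc 1 m) :
    β a * tauAt (Icc 1 m) α β a = α a * tauAt (Icc 1 m) α β (-a) := by
  have hS := insert_erase ha
  have hmem : a ∉ (Icc 1 m).erase a := notMem_erase _ _
  obtain ⟨n, rfl⟩ : ∃ n, a = n + 1 := ⟨a - 1, by have := (mem_Icc.1 ha).1; omega⟩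
  rw [← hS, tauAt_self hmem, tauAt_neg_self hmem, prod_sign_sub_erase ha]
  rw [Nat.add_sub_cancel, pow_succ]
  ring

theorem Icc_one_succ (m : ℕ) : Icc 1 (m + 1) = insert (m + 1) (Icc 1 m) := by
  ext x
  simp only [mem_Icc, mem_insert]
  omega

/-- At the largest index all signs in `tauAt_self` are positive, so the factors m + 1 + k are common
and the sum drops to m. -/
theorem tauAt_top (α β : ℕ → K) (m : ℕ) :
    tauAt (Icc 1 (m + 1)) α β ((m + 1 : ℕ) : K) =
      (-1) ^ (m + 1) * α (m + 1) * (∏ k ∈ Icc 1 (m + 1), (((m + 1 : ℕ) : K) + k)) *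
        tau (Icc 1 m) α β := by
  have hm : m + 1 ∉ Icc 1 m := by simp
  rw [Icc_one_succ, tauAt_self hm, prod_insert hm]
  have : tau (Icc 1 m) (fun k => α k * (((m + 1 : ℕ) : K) + k)) (fun j => algebraMap ℚ K
      (SignType.sign (((m + 1 : ℕ) : ℚ) - j) : ℚ) * (β j * (((m + 1 : ℕ) : K) + j))) =
      (∏ k ∈ Icc 1 m, (((m + 1 : ℕ) : K) + k)) * tau (Icc 1 m) α β := by
    rw [← tau_mul]
    refine tau_congr (fun i _ => mul_comm _ _) fun j hj => ?_
    have hlt : j < m + 1 := by have := (mem_Icc.1 hj).2; omega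
    rw [sign_pos (sub_pos.2 (Nat.cast_lt.2 hlt))]
    simp [mul_comm]
  rw [this]
  ring

theorem tauAt_neg_top (α β : ℕ → K) (m : ℕ) :
    tauAt (Icc 1 (m + 1)) α β (-((m + 1 : ℕ) : K)) =
      (-1) ^ (m + 1) * β (m + 1) * (∏ k ∈ Icc 1 (m + 1), (((m + 1 : ℕ) : K) + k)) *
        tau (Icc 1 m) α β := by
  have hm : m + 1 ∉ Icc 1 m := by simp
  rw [Icc_one_succ, tauAt_neg_self hm, prod_insert hm]
  have h1 : tau (Icc 1 m) (fun k => α k * (((m + 1 : ℕ) : K) + k)) (fun j => algebraMap ℚ K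
      (SignType.sign (((m + 1 : ℕ) : ℚ) - j) : ℚ) * (β j * (((m + 1 : ℕ) : K) + j))) =
      (∏ k ∈ Icc 1 m, (((m + 1 : ℕ) : K) + k)) * tau (Icc 1 m) α β := by
    rw [← tau_mul]
    refine tau_congr (fun i _ => mul_comm _ _) fun j hj => ?_
    have hlt : j < m + 1 := by have := (mem_Icc.1 hj).2; omega
    rw [sign_pos (sub_pos.2 (Nat.cast_lt.2 hlt))]
    simp [mul_comm]
  have h2 : ∏ k ∈ Icc 1 m, algebraMap ℚ K (SignType.sign ((k : ℚ) - (m + 1 : ℕ)) : ℚ) =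
      (-1) ^ m := by
    have := prod_sign_sub_erase (K := K) (m := m + 1) (a := m + 1) (by simp)
    rwa [Icc_one_succ, erase_insert hm] at this
  rw [h1, h2, pow_succ]
  ring

/-- The sum is split according to the side on which m + 1 lies. Multiplying its interaction with k
by m + 1 - k leaves m + 1 + k, so the two halves are values of `tauAt` at ±(m + 1). -/
theorem prod_mul_tau_succ (α β : ℕ → K) (m : ℕ) :
    (∏ k ∈ Icc 1 m, (((m + 1 : ℕ) : K) - k)) * tau (Icc 1 (m + 1)) α β =
      β (m + 1) * tauAt (Icc 1 m) α β ((m + 1 : ℕ) : K) -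
        α (m + 1) * tauAt (Icc 1 m) α β (-((m + 1 : ℕ) : K)) := by
  have hm : m + 1 ∉ Icc 1 m := by simp
  have key : ∀ j ∈ Icc 1 m, (((m + 1 : ℕ) : K) - j) * algebraMap ℚ K
      (|(((m + 1 : ℕ) : ℚ) + j) / (((m + 1 : ℕ) : ℚ) - j)|) = ((m + 1 : ℕ) : K) + j := by
    intro j hj
    have hlt : j < m + 1 := by have := (mem_Icc.1 hj).2; omega
    have hp : (0 : ℚ) < ((m + 1 : ℕ) : ℚ) - j := sub_pos.2 (Nat.cast_lt.2 hlt)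
    rw [abs_of_nonneg (by positivity)]
    have := congrArg (algebraMap ℚ K) (mul_div_cancel₀ (((m + 1 : ℕ) : ℚ) + j) hp.ne')
    simpa only [map_mul, map_sub, map_add, map_natCast] using this
  have key' : ∀ j ∈ Icc 1 m, (((m + 1 : ℕ) : K) - j) * algebraMap ℚ K
      (|((j : ℚ) + (m + 1 : ℕ)) / ((j : ℚ) - (m + 1 : ℕ))|) = ((m + 1 : ℕ) : K) + j := by
    intro j hj
    rw [← key j hj, abs_div, abs_div, abs_sub_comm, add_comm (j : ℚ)]
  rw [Icc_one_succ, tau_insert hm, mul_add, mul_left_comm, mul_left_comm _ ((-1) ^ (m + 1) * _),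
    ← tau_mul, ← tau_mul]
  have h1 : tau (Icc 1 m) (fun i => (((m + 1 : ℕ) : K) - i) * (algebraMap ℚ K
      |((i : ℚ) + (m + 1 : ℕ)) / ((i : ℚ) - (m + 1 : ℕ))| * α i))
      (fun i => (((m + 1 : ℕ) : K) - i) * β i) = tauAt (Icc 1 m) α β ((m + 1 : ℕ) : K) := by
    refine tau_congr (fun i hi => ?_) fun i _ => mul_comm _ _
    linear_combination α i * key' i hi
  have h2 : tauAt (Icc 1 m) α β (-((m + 1 : ℕ) : K)) = (-1) ^ m *
      tau (Icc 1 m) (fun i => (((m + 1 : ℕ) : K) - i) * α i) (fun i => (((m + 1 : ℕ) : K) - i) *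
        (algebraMap ℚ K |(((m + 1 : ℕ) : ℚ) + i) / (((m + 1 : ℕ) : ℚ) - i)| * β i)) := by
    have : (∏ _k ∈ Icc 1 m, (-1 : K)) = (-1) ^ m := by simp
    rw [← this, ← tau_mul]
    refine tau_congr (fun i hi => by ring) fun i hi => ?_
    linear_combination β i * key i hi
  rw [h1, h2, pow_succ]
  ring

end Tau

/-! ### Top coefficients read through reversed polynomials. -/

section Reflect

variable {K : Type*} [CommRing K]

/-- `f` has degree at most `n` and `g` is its reflection `X ^ n * f (1 / X)`. -/
structure IsReflection (n : ℕ) (f g : K[X]) : Prop where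
  natDegree_le : f.natDegree ≤ n
  reflect_eq : reflect n f = g

theorem IsReflection.mul {m n : ℕ} {f g f' g' : K[X]} (h : IsReflection m f g)
    (h' : IsReflection n f' g') : IsReflection (m + n) (f * f') (g * g') :=
  ⟨natDegree_mul_le_of_le h.natDegree_le h'.natDegree_le, by
    rw [reflect_mul _ _ h.natDegree_le h'.natDegree_le, h.reflect_eq, h'.reflect_eq]⟩

theorem IsReflection.sub {n : ℕ} {f g f' g' : K[X]} (h : IsReflection n f g)
    (h' : IsReflection n f' g') : IsReflection n (f - f') (g - g') :=
  ⟨natDegree_sub_le_of_le h.natDegree_le h'.natDegree_le |>.trans (max_self n).le, by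
    rw [reflect_sub, h.reflect_eq, h'.reflect_eq]⟩

theorem IsReflection.C_mul {n : ℕ} {f g : K[X]} (h : IsReflection n f g) (c : K) :
    IsReflection n (C c * f) (C c * g) :=
  ⟨(natDegree_C_mul_le _ _).trans h.natDegree_le, by rw [reflect_C_mul, h.reflect_eq]⟩

theorem IsReflection.sum {ι : Type*} {n : ℕ} {s : Finset ι} {f g : ι → K[X]}
    (h : ∀ i ∈ s, IsReflection n (f i) (g i)) : IsReflection n (∑ i ∈ s, f i) (∑ i ∈ s, g i) := by
  classical
  induction s using Finset.induction_on with
  | empty => exact ⟨by simp, by simp⟩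
  | insert a s ha ih =>
    have h1 := h a (mem_insert_self a s)
    have h2 := ih fun i hi => h i (mem_insert_of_mem hi)
    rw [sum_insert ha, sum_insert ha]
    exact ⟨natDegree_add_le_of_degree_le h1.natDegree_le h2.natDegree_le, by
      rw [reflect_add, h1.reflect_eq, h2.reflect_eq]⟩

theorem IsReflection.prod {ι : Type*} {d : ℕ} {s : Finset ι} {f g : ι → K[X]}
    (h : ∀ i ∈ s, IsReflection d (f i) (g i)) :
    IsReflection (s.card * d) (∏ i ∈ s, f i) (∏ i ∈ s, g i) := by
  classical
  induction s using Finset.induction_on with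
  | empty => exact ⟨by simp, by simp [reflect_one]⟩
  | insert a s ha ih =>
    rw [prod_insert ha, prod_insert ha, card_insert_of_notMem ha, add_mul, one_mul, add_comm]
    exact (h a (mem_insert_self a s)).mul (ih fun i hi => h i (mem_insert_of_mem hi))

theorem isReflection_linear (r : K) : IsReflection 1 (X + C r) (1 + C r * X) :=
  ⟨by compute_degree, by simp [reflect_add, reflect_C]⟩

theorem isReflection_quadratic (p r : K) :
    IsReflection 2 (C p * X ^ 2 + C r) (C p + C r * X ^ 2) := by
  refine ⟨?_, ?_⟩
  · compute_degree
  · rw [reflect_add, reflect_C, reflect_C_mul_X_pow, revAt_le le_rfl]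
    simp

/-- A polynomial of degree at most `n + 2` whose three top coefficients vanish. -/
theorem IsReflection.natDegree_lt {n : ℕ} {f g : K[X]} (h : IsReflection (n + 2) f g)
    (h0 : g.coeff 0 = 0) (h1 : g.coeff 1 = 0) (h2 : g.coeff 2 = 0) : f = 0 ∨ f.natDegree < n := by
  by_contra! hcon
  obtain ⟨hf, hn⟩ := hcon
  have hle := h.natDegree_le
  have hc : ∀ k ≤ 2, g.coeff k = f.coeff (n + 2 - k) := fun k hk => by
    rw [← h.reflect_eq, coeff_reflect, revAt_le (by omega)]
  rw [hc _ (by omega)] at h0 h1 h2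
  have : f.coeff f.natDegree = 0 := by
    have : f.natDegree = n + 2 - 0 ∨ f.natDegree = n + 2 - 1 ∨ f.natDegree = n + 2 - 2 := by omega
    rcases this with h | h | h <;> rw [h] <;> assumption
  exact hf (leadingCoeff_eq_zero.1 this)

theorem coeff_mul_two (f g : K[X]) :
    (f * g).coeff 2 = f.coeff 0 * g.coeff 2 + f.coeff 1 * g.coeff 1 + f.coeff 2 * g.coeff 0 := by
  simp [coeff_mul, Finset.Nat.antidiagonal_succ]
  ring

theorem coeff_C_add_C_mul_X_sq (p r : K) :
    (C p + C r * X ^ 2).coeff 0 = p ∧ (C p + C r * X ^ 2).coeff 1 = 0 ∧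
      (C p + C r * X ^ 2).coeff 2 = r := by
  simp [coeff_X_pow, coeff_C]

/-- The last identity is Newton's 2e₂ = p₁² - p₂, kept undivided because K is only a commutative
ring. -/
theorem coeff_prod_one_add {ι : Type*} (s : Finset ι) (r : ι → K) :
    (∏ i ∈ s, (1 + C (r i) * X)).coeff 0 = 1 ∧
    (∏ i ∈ s, (1 + C (r i) * X)).coeff 1 = ∑ i ∈ s, r i ∧
    2 * (∏ i ∈ s, (1 + C (r i) * X)).coeff 2 = (∑ i ∈ s, r i) ^ 2 - ∑ i ∈ s, r i ^ 2 := by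
  classical
  induction s using Finset.induction_on with
  | empty => simp [coeff_one]
  | insert a s ha ih =>
    obtain ⟨h0, h1, h2⟩ := ih
    have c0 : (1 + C (r a) * X).coeff 0 = 1 := by simp
    have c1 : (1 + C (r a) * X).coeff 1 = r a := by simp [coeff_one]
    have c2 : (1 + C (r a) * X).coeff 2 = 0 := by simp [coeff_one]
    rw [prod_insert ha, sum_insert ha, sum_insert ha, mul_coeff_zero, mul_coeff_one,
      coeff_mul_two, c0, c1, c2, h0, h1]
    refine ⟨by ring, by ring, ?_⟩
    linear_combination h2

theorem coeff_prod_one_add_sq {ι : Type*} (s : Finset ι) (r : ι → K) :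
    (∏ i ∈ s, (C 1 + C (r i) * X ^ 2)).coeff 0 = 1 ∧
    (∏ i ∈ s, (C 1 + C (r i) * X ^ 2)).coeff 1 = 0 ∧
    (∏ i ∈ s, (C 1 + C (r i) * X ^ 2)).coeff 2 = ∑ i ∈ s, r i := by
  classical
  induction s using Finset.induction_on with
  | empty => simp [coeff_one]
  | insert a s ha ih =>
    obtain ⟨h0, h1, h2⟩ := ih
    obtain ⟨c0, c1, c2⟩ := coeff_C_add_C_mul_X_sq 1 (r a)
    rw [prod_insert ha, sum_insert ha, mul_coeff_zero, mul_coeff_one,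
      coeff_mul_two, c0, c1, c2, h0, h1, h2]
    refine ⟨by ring, by ring, by ring⟩

theorem sum_shift {S I : Finset ℕ} (hI : I ⊆ S) (e σ : K) :
    ∑ i ∈ S, (if i ∈ I then e * (σ + i) else e * (σ - i)) =
      e * (S.card * σ + (2 * ((∑ i ∈ I, i : ℕ) : K) - ((∑ i ∈ S, i : ℕ) : K))) := by
  rw [← sum_sdiff hI, ← sum_sdiff (f := fun i => i) hI,
    sum_congr rfl fun i hi => if_neg (mem_sdiff.1 hi).2, sum_congr rfl fun i hi => if_pos hi,
    ← card_sdiff_add_card_eq_card hI]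
  push_cast
  rw [← mul_sum, ← mul_sum, sum_sub_distrib, sum_add_distrib, sum_const, sum_const,
    nsmul_eq_mul, nsmul_eq_mul]
  ring

theorem sum_shift_sq {S I : Finset ℕ} (hI : I ⊆ S) {e : K} (he : e ^ 2 = 1) (σ : K) :
    ∑ i ∈ S, (if i ∈ I then e * (σ + i) else e * (σ - i)) ^ 2 =
      S.card * σ ^ 2 + 2 * σ * (2 * ((∑ i ∈ I, i : ℕ) : K) - ((∑ i ∈ S, i : ℕ) : K)) +
        ∑ i ∈ S, (i : K) ^ 2 := by
  have h := sum_shift hI (1 : K) σ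
  have : ∀ i ∈ S, (if i ∈ I then e * (σ + i) else e * (σ - i)) ^ 2 =
      (i : K) ^ 2 - σ ^ 2 + 2 * σ * (if i ∈ I then 1 * (σ + i) else 1 * (σ - i)) := fun i _ => by
    split_ifs
    · linear_combination (σ + i) ^ 2 * he
    · linear_combination (σ - i) ^ 2 * he
  rw [sum_congr rfl this, sum_add_distrib, sum_sub_distrib, ← mul_sum, h, sum_const, nsmul_eq_mul]
  ring

end Reflect

/-! ### Leading coefficients as moments of 2∑I - ∑S. -/

section Moments

variable {K : Type*} [CommRing K] [Algebra ℚ K]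

/-- The moments of the statistic `2 ∑ I - ∑ S` in the expansion of `tau S α β`. -/
def tauMoment (k : ℕ) (S : Finset ℕ) (α β : ℕ → K) : K :=
  ∑ I ∈ S.powerset, algebraMap ℚ K (crossWeight S I) * ((∏ i ∈ I, α i) * ∏ j ∈ S \ I, β j) *
    (2 * ((∑ i ∈ I, i : ℕ) : K) - ((∑ i ∈ S, i : ℕ) : K)) ^ k

theorem tauMoment_zero (S : Finset ℕ) (α β : ℕ → K) :
    tauMoment 0 S α β = tau S α β := by
  simp [tauMoment, tau]

theorem prod_mul_prod_sdiff {M : Type*} [CommMonoid M] {S I : Finset ℕ} (hI : I ⊆ S)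
    (f g : ℕ → M) :
    (∏ i ∈ I, f i) * ∏ j ∈ S \ I, g j = ∏ i ∈ S, if i ∈ I then f i else g i := by
  rw [← prod_sdiff hI, mul_comm]
  congr 1
  · exact prod_congr rfl fun i hi => by rw [if_neg (mem_sdiff.1 hi).2]
  · exact prod_congr rfl fun i hi => by rw [if_pos hi]

theorem tau_C_mul_linear (S : Finset ℕ) (α β p q : ℕ → K) (f : K → K[X]) :
    tau S (fun i => C (α i) * f (p i)) (fun j => C (β j) * f (q j)) =
      ∑ I ∈ S.powerset, C (algebraMap ℚ K (crossWeight S I) *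
        ((∏ i ∈ I, α i) * ∏ j ∈ S \ I, β j)) * ∏ i ∈ S, f (if i ∈ I then p i else q i) := by
  refine sum_congr rfl fun I hI => ?_
  have h := prod_mul_prod_sdiff (mem_powerset.1 hI) (fun i => f (p i)) (fun i => f (q i))
  simp_rw [apply_ite f]
  rw [← h, prod_mul_distrib, prod_mul_distrib]
  simp only [map_mul, map_prod, Polynomial.algebraMap_apply]
  ring

theorem isReflection_tau (S : Finset ℕ) (α β p q : ℕ → K) :
    IsReflection S.card (tau S (fun i => C (α i) * (X + C (p i))) (fun j => C (β j) * (X + C (q j))))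
      (tau S (fun i => C (α i) * (1 + C (p i) * X)) (fun j => C (β j) * (1 + C (q j) * X))) := by
  rw [tau_C_mul_linear S α β p q (fun r => X + C r),
    tau_C_mul_linear S α β p q (fun r => 1 + C r * X)]
  refine IsReflection.sum fun I _ => IsReflection.C_mul ?_ _
  have := IsReflection.prod (d := 1) (s := S)
    fun i _ => isReflection_linear (if i ∈ I then p i else q i)
  rwa [mul_one] at this

/-- The first two power sums of the roots depend on I only through 2∑I - ∑S. The cases e = 1 and e =
-1 serve the factors at σ + u and σ - u. -/
theorem coeff_tau_one_add (S : Finset ℕ) (α β : ℕ → K) {e : K} (he : e ^ 2 = 1) (σ : K) :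
    let f : K[X] := tau S (fun i => C (α i) * (1 + C (e * (σ + i)) * X))
      (fun j => C (β j) * (1 + C (e * (σ - j)) * X))
    f.coeff 0 = tauMoment 0 S α β ∧
    f.coeff 1 = e * (S.card * σ * tauMoment 0 S α β + tauMoment 1 S α β) ∧
    2 * f.coeff 2 = (S.card ^ 2 * σ ^ 2 - S.card * σ ^ 2 - ∑ i ∈ S, (i : K) ^ 2) *
        tauMoment 0 S α β + (2 * S.card * σ - 2 * σ) * tauMoment 1 S α β + tauMoment 2 S α β := by
  intro f
  have hf : f = _ := tau_C_mul_linear S α β (fun i => e * (σ + i)) (fun i => e * (σ - i))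
    (fun r => 1 + C r * X)
  rw [hf]
  simp only [finsetSum_coeff, coeff_C_mul, tauMoment, mul_sum, ← sum_add_distrib]
  refine ⟨sum_congr rfl fun I hI => ?_, sum_congr rfl fun I hI => ?_, sum_congr rfl fun I hI => ?_⟩
  all_goals
    have hI := mem_powerset.1 hI
    obtain ⟨h0, h1, h2⟩ := coeff_prod_one_add S
      (fun i : ℕ => if i ∈ I then e * (σ + i) else e * (σ - i))
    rw [sum_shift hI] at h1
    rw [sum_shift hI, sum_shift_sq hI he] at h2
  · rw [h0]; ring
  · rw [h1]; ring
  · rw [mul_left_comm, h2]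
    linear_combination (algebraMap ℚ K (crossWeight S I) * ((∏ i ∈ I, α i) * ∏ j ∈ S \ I, β j)) *
      (S.card * σ + (2 * ((∑ i ∈ I, i : ℕ) : K) - ((∑ i ∈ S, i : ℕ) : K))) ^ 2 * he

end Moments

/-! ### Divisibility of the bilinear pencil. -/

section Interpolation

variable {K : Type*} [Field K] [CharZero K]

/-- The polynomial `∑_I (…) ∏_{i ∈ I} (X + e (σ + i)) ∏_{j ∉ I} (X + e (σ - j))`. -/
def tauPoly (S : Finset ℕ) (α β : ℕ → K) (e σ : K) : K[X] :=
  tau S (fun i => C (α i) * (X + C (e * (σ + i)))) (fun j => C (β j) * (X + C (e * (σ - j))))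

theorem eval_tauPoly_one (S : Finset ℕ) (α β : ℕ → K) (σ u : K) :
    (tauPoly S α β 1 σ).eval u = tauAt S α β (σ + u) := by
  rw [tauPoly, ← coe_evalRingHom, map_tau, tauAt]
  refine tau_congr (fun i _ => ?_) fun i _ => ?_ <;>
  · simp only [coe_evalRingHom, eval_mul, eval_add, eval_C, eval_X]
    ring

theorem eval_tauPoly_neg_one (S : Finset ℕ) (α β : ℕ → K) (σ u : K) :
    (tauPoly S α β (-1) σ).eval u = (-1) ^ S.card * tauAt S α β (σ - u) := by
  rw [tauPoly, ← coe_evalRingHom, map_tau, tauAt, ← prod_const, ← tau_mul]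
  refine tau_congr (fun i _ => ?_) fun i _ => ?_ <;>
  · simp only [coe_evalRingHom, eval_mul, eval_add, eval_C, eval_X]
    ring

/-- Passing from e = 1 to e = -1 changes the sign of the subleading coefficient, so it cancels in
the product. -/
theorem exists_isReflection_tauPoly_mul (S : Finset ℕ) (α β : ℕ → K) (σ : K) :
    ∃ g : K[X], IsReflection (S.card + S.card) (tauPoly S α β 1 σ * tauPoly S α β (-1) σ) g ∧
      g.coeff 0 = tauMoment 0 S α β ^ 2 ∧ g.coeff 1 = 0 ∧
      g.coeff 2 = tauMoment 0 S α β * tauMoment 2 S α β - tauMoment 1 S α β ^ 2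
        - 2 * σ * tauMoment 0 S α β * tauMoment 1 S α β
        - (S.card * σ ^ 2 + ∑ i ∈ S, (i : K) ^ 2) * tauMoment 0 S α β ^ 2 := by
  obtain ⟨p0, p1, p2⟩ := coeff_tau_one_add S α β (e := 1) (by ring) σ
  obtain ⟨q0, q1, q2⟩ := coeff_tau_one_add S α β (e := -1) (by ring) σ
  refine ⟨_, (isReflection_tau S α β _ _).mul (isReflection_tau S α β _ _), ?_⟩
  rw [mul_coeff_zero, mul_coeff_one, coeff_mul_two, p0, p1, q0, q1]
  refine ⟨by ring, by ring, ?_⟩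
  linear_combination tauMoment 0 S α β / 2 * (p2 + q2)

theorem exists_isReflection_pencil (S : Finset ℕ) (α β : ℕ → K) (σ t W : K) :
    ∃ g : K[X], IsReflection (S.card * 2 + 2)
        (C W * ((C 1 * X ^ 2 + C (-t)) * (tauPoly S α β 1 σ * tauPoly S α β (-1) σ))) g ∧
      g.coeff 0 = W * tauMoment 0 S α β ^ 2 ∧ g.coeff 1 = 0 ∧
      g.coeff 2 = W * (tauMoment 0 S α β * tauMoment 2 S α β - tauMoment 1 S α β ^ 2
        - 2 * σ * tauMoment 0 S α β * tauMoment 1 S α β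
        - (S.card * σ ^ 2 + ∑ i ∈ S, (i : K) ^ 2) * tauMoment 0 S α β ^ 2
        - t * tauMoment 0 S α β ^ 2) := by
  obtain ⟨g, hg, g0, g1, g2⟩ := exists_isReflection_tauPoly_mul S α β σ
  obtain ⟨c0, c1, c2⟩ := coeff_C_add_C_mul_X_sq 1 (-t)
  have hr := ((isReflection_quadratic 1 (-t)).mul hg).C_mul W
  rw [show 2 + (S.card + S.card) = S.card * 2 + 2 by ring] at hr
  refine ⟨_, hr, ?_⟩
  rw [coeff_C_mul, coeff_C_mul, coeff_C_mul, mul_coeff_zero, mul_coeff_one, coeff_mul_two,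
    c0, c1, c2, g0, g1, g2]
  refine ⟨by ring, by ring, by ring⟩

/-- The value of the residual linear factor of the bilinear pencil at `u ^ 2 = t`. -/
def pencilFactor (m : ℕ) (α β : ℕ → K) (Z W s t x : K) : K :=
  (W - Z) * tauMoment 0 (Icc 1 m) α β ^ 2 * x +
    ((W - Z) * (tauMoment 0 (Icc 1 m) α β * tauMoment 2 (Icc 1 m) α β
        - tauMoment 1 (Icc 1 m) α β ^ 2)
      - (W + Z) * (tauMoment 0 (Icc 1 m) α β * tauMoment 1 (Icc 1 m) α β)
      - (W * t - Z * s + (W - Z) * ((∑ i ∈ Icc 1 m, i : ℕ) : K)) *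
        tauMoment 0 (Icc 1 m) α β ^ 2)

/-- The bilinear pencil in `tauAt` is divisible by `∏ ((i - 1/2)^2 - u^2)`, and the quotient is
the affine function `pencilFactor` of `u^2`. -/
theorem tauAt_pencil {m : ℕ} {α β : ℕ → K} {Z W s t : K}
    (hroot : ∀ i ∈ Icc 1 m,
      W * (((i : K) - 1 / 2) ^ 2 - t) *
          (tauAt (Icc 1 m) α β i * tauAt (Icc 1 m) α β (1 - i)) =
        Z * (((i : K) - 1 / 2) ^ 2 - s) *
          (tauAt (Icc 1 m) α β (-i) * tauAt (Icc 1 m) α β (i - 1))) (u : K) :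
    W * (u ^ 2 - t) * (tauAt (Icc 1 m) α β (1 / 2 + u) * tauAt (Icc 1 m) α β (1 / 2 - u)) -
      Z * (u ^ 2 - s) * (tauAt (Icc 1 m) α β (-1 / 2 + u) * tauAt (Icc 1 m) α β (-1 / 2 - u)) =
    (∏ i ∈ Icc 1 m, (((i : K) - 1 / 2) ^ 2 - u ^ 2)) * pencilFactor m α β Z W s t (u ^ 2) := by
  classical
  set S := Icc 1 m with hS
  have hcard : S.card = m := by simp [hS]
  obtain ⟨g, hg, g0, g1, g2⟩ := exists_isReflection_pencil S α β (1 / 2) t W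
  obtain ⟨h, hh, h0, h1, h2⟩ := exists_isReflection_pencil S α β (-1 / 2) s Z
  set l₁ : K := (W - Z) * tauMoment 0 S α β ^ 2 with hl₁
  set l₀ : K := pencilFactor m α β Z W s t 0 with hl₀
  have hlin : ∀ x, pencilFactor m α β Z W s t x = l₁ * x + l₀ := fun x => by
    rw [hl₀, pencilFactor, pencilFactor, hl₁]
    ring
  have hprod := (IsReflection.prod (s := S) fun i _ =>
    isReflection_quadratic 1 (-((i : K) - 1 / 2) ^ 2)).mul (isReflection_quadratic l₁ l₀)
  obtain ⟨p0, p1, p2⟩ := coeff_prod_one_add_sq S fun i : ℕ => -((i : K) - 1 / 2) ^ 2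
  obtain ⟨c0, c1, c2⟩ := coeff_C_add_C_mul_X_sq l₁ l₀
  -- The terms ∑i² and m/4 also occur in the pencil and cancel there, since σ² = 1/4; only ∑i
  -- survives in `pencilFactor`.
  have hsum : ∑ i ∈ S, -((i : K) - 1 / 2) ^ 2 =
      ((∑ i ∈ S, i : ℕ) : K) - ∑ i ∈ S, (i : K) ^ 2 - m / 4 := by
    have : ∀ i ∈ S, -((i : K) - 1 / 2) ^ 2 = (i : K) - (i : K) ^ 2 - 1 / 4 := fun i _ => by ring
    rw [sum_congr rfl this, sum_sub_distrib, sum_sub_distrib, sum_const, hcard, nsmul_eq_mul]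
    push_cast
    ring
  have hF := (hg.sub hh).sub hprod
  set F : K[X] := C W * ((C 1 * X ^ 2 + C (-t)) * (tauPoly S α β 1 (1 / 2) *
      tauPoly S α β (-1) (1 / 2))) - C Z * ((C 1 * X ^ 2 + C (-s)) *
      (tauPoly S α β 1 (-1 / 2) * tauPoly S α β (-1) (-1 / 2))) -
      (∏ i ∈ S, (C 1 * X ^ 2 + C (-((i : K) - 1 / 2) ^ 2))) * (C l₁ * X ^ 2 + C l₀) with hFdef
  have heval : ∀ x : K, F.eval x = (-1) ^ m *
      (W * (x ^ 2 - t) * (tauAt S α β (1 / 2 + x) * tauAt S α β (1 / 2 - x)) -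
        Z * (x ^ 2 - s) * (tauAt S α β (-1 / 2 + x) * tauAt S α β (-1 / 2 - x)) -
        (∏ i ∈ S, (((i : K) - 1 / 2) ^ 2 - x ^ 2)) * (l₁ * x ^ 2 + l₀)) := by
    intro x
    have hP : ∏ i ∈ S, (x ^ 2 + -((i : K) - 1 / 2) ^ 2) =
        (-1) ^ m * ∏ i ∈ S, (((i : K) - 1 / 2) ^ 2 - x ^ 2) := by
      rw [← hcard, ← prod_const, ← prod_mul_distrib]
      exact prod_congr rfl fun i _ => by ring
    simp only [hFdef, eval_sub, eval_mul, eval_add, eval_C, eval_X, eval_pow, eval_prod,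
      eval_tauPoly_one, eval_tauPoly_neg_one, one_mul, hcard, hP]
    ring
  -- The three top coefficients of F vanish by the choice of l₁ and l₀, so a nonzero F would have
  -- degree below 2m while having 2m roots.
  have hF0 : F = 0 := by
    have hg0 : (g - h - (∏ i ∈ S, (C 1 + C (-((i : K) - 1 / 2) ^ 2) * X ^ 2)) *
        (C l₁ + C l₀ * X ^ 2)).coeff 0 = 0 := by
      rw [coeff_sub, coeff_sub, mul_coeff_zero, g0, h0, p0, c0, hl₁]
      ring
    have hg1 : (g - h - (∏ i ∈ S, (C 1 + C (-((i : K) - 1 / 2) ^ 2) * X ^ 2)) *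
        (C l₁ + C l₀ * X ^ 2)).coeff 1 = 0 := by
      rw [coeff_sub, coeff_sub, mul_coeff_one, g1, h1, p1, c1]
      ring
    have hg2 : (g - h - (∏ i ∈ S, (C 1 + C (-((i : K) - 1 / 2) ^ 2) * X ^ 2)) *
        (C l₁ + C l₀ * X ^ 2)).coeff 2 = 0 := by
      rw [coeff_sub, coeff_sub, coeff_mul_two, g2, h2, p0, p1, p2, c0, c1, c2, hsum, hl₁, hl₀,
        pencilFactor, hcard]
      ring
    rcases hF.natDegree_lt hg0 hg1 hg2 with h | h
    · exact h
    -- The points k - 1/2 with 1 - m ≤ k ≤ m are exactly the ±(i - 1/2) with 1 ≤ i ≤ m.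
    · refine eq_zero_of_natDegree_lt_card_of_eval_eq_zero' F
        ((Icc (1 - m : ℤ) m).image fun k : ℤ => (k : K) - 1 / 2) ?_ ?_
      · have hi : ∀ i ∈ S, F.eval ((i : K) - 1 / 2) = 0 ∧ F.eval (-((i : K) - 1 / 2)) = 0 := by
          intro i hi
          have hz : ∏ j ∈ S, (((j : K) - 1 / 2) ^ 2 - ((i : K) - 1 / 2) ^ 2) = 0 :=
            prod_eq_zero hi (sub_self _)
          have hr := hroot i hi
          rw [heval, heval, neg_sq, hz]
          rw [show (1 : K) / 2 + ((i : K) - 1 / 2) = i by ring,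
            show (1 : K) / 2 - ((i : K) - 1 / 2) = 1 - i by ring,
            show (-1 : K) / 2 + ((i : K) - 1 / 2) = i - 1 by ring,
            show (-1 : K) / 2 - ((i : K) - 1 / 2) = -i by ring,
            show (1 : K) / 2 + -((i : K) - 1 / 2) = 1 - i by ring,
            show (1 : K) / 2 - -((i : K) - 1 / 2) = i by ring,
            show (-1 : K) / 2 + -((i : K) - 1 / 2) = -i by ring,
            show (-1 : K) / 2 - -((i : K) - 1 / 2) = i - 1 by ring]
          constructor <;> linear_combination (-1) ^ m * hr
        intro x hx
        obtain ⟨k, hk, rfl⟩ := mem_image.1 hx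
        rw [mem_Icc] at hk
        rcases le_or_gt 1 k with hk1 | hk1
        · have := (hi k.toNat (by rw [hS, mem_Icc]; omega)).1
          rwa [← Int.cast_natCast, Int.toNat_of_nonneg (by omega)] at this
        · have := (hi (1 - k).toNat (by rw [hS, mem_Icc]; omega)).2
          rw [← Int.cast_natCast, Int.toNat_of_nonneg (by omega)] at this
          rw [← this]
          push_cast
          congr 1
          ring
      · rw [card_image_of_injective _ fun a b hab => by simpa using hab, Int.card_Icc]
        omega
  have := heval u
  rw [hF0, eval_zero] at this
  rw [hlin]
  have hne : ((-1 : K)) ^ m ≠ 0 := pow_ne_zero _ (neg_ne_zero.2 one_ne_zero)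
  exact sub_eq_zero.1 ((mul_eq_zero.1 this.symm).resolve_left hne)

end Interpolation

/-! ### Specialization to the Umemura weights. -/

section Umemura

/-- `∏_{s = 1}^{i} ((2 s - 1)^2 - 4 b^2)`. -/
def shiftedProd {K : Type*} [CommRing K] (b : K) (i : ℕ) : K :=
  ∏ s ∈ Icc 1 i, ((2 * (s : K) - 1) ^ 2 - 4 * b ^ 2)

/-- Umemura's polynomial as a function of the parameters and of `Z = z ^ 2`, `W = w ^ 2`. -/
def umemuraTau {K : Type*} [CommRing K] [Algebra ℚ K] (m : ℕ) (b₁ b₂ Z W : K) : K :=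
  tau (Icc 1 m) (fun i => shiftedProd b₁ i * Z ^ i) (fun j => shiftedProd b₂ j * W ^ j)

theorem shiftedProd_zero {K : Type*} [CommRing K] (b : K) : shiftedProd b 0 = 1 := by
  simp [shiftedProd]

theorem shiftedProd_succ {K : Type*} [CommRing K] (b : K) (i : ℕ) :
    shiftedProd b (i + 1) = shiftedProd b i * ((2 * (i : K) + 1) ^ 2 - 4 * b ^ 2) := by
  rw [shiftedProd, shiftedProd, prod_Icc_succ_top (by omega)]
  push_cast
  ring

theorem shiftedProd_neg {K : Type*} [CommRing K] (b : K) (i : ℕ) :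
    shiftedProd (-b) i = shiftedProd b i := by
  simp [shiftedProd]

theorem map_shiftedProd {K L : Type*} [CommRing K] [CommRing L] (f : K →+* L) (b : K) (i : ℕ) :
    f (shiftedProd b i) = shiftedProd (f b) i := by
  simp [shiftedProd, map_prod, map_ofNat]

theorem map_umemuraTau {K L : Type*} [CommRing K] [CommRing L] [Algebra ℚ K] [Algebra ℚ L]
    (f : K →+* L) (m : ℕ) (b₁ b₂ Z W : K) :
    f (umemuraTau m b₁ b₂ Z W) = umemuraTau m (f b₁) (f b₂) (f Z) (f W) := by
  simp [umemuraTau, map_tau, map_shiftedProd]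

theorem umemuraTau_zero {K : Type*} [CommRing K] [Algebra ℚ K] (b₁ b₂ Z W : K) :
    umemuraTau 0 b₁ b₂ Z W = 1 := by
  rw [umemuraTau, Icc_eq_empty (by omega), tau_empty]

variable {K : Type*} [Field K]

theorem shiftedProd_ne_zero {b : K} (hb : ∀ s : ℕ, (2 * (s : K) - 1) ^ 2 - 4 * b ^ 2 ≠ 0) (i : ℕ) :
    shiftedProd b i ≠ 0 :=
  prod_ne_zero_iff.2 fun s _ => hb s

/-- Each factor splits as (2s - 1 - 2b)(2s - 1 + 2b); under b ↦ b + 1 both strings shift by one step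
and the ratio telescopes to its end factors. -/
theorem shiftedProd_add_one [CharZero K] (b : K) (i : ℕ) :
    shiftedProd (b + 1) i * (1 / 2 + b - i) = shiftedProd b i * (1 / 2 + b + i) := by
  induction i with
  | zero => simp [shiftedProd_zero]
  | succ i ih =>
    rw [shiftedProd_succ, shiftedProd_succ]
    push_cast
    linear_combination (-4 * (1 / 2 + b + i + 1) * (1 / 2 + b - i - 1)) * ih

theorem shiftedProd_sub_one [CharZero K] (b : K) (i : ℕ) :
    shiftedProd (b - 1) i * (1 / 2 - b - i) = shiftedProd b i * (1 / 2 - b + i) := by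
  have h := shiftedProd_add_one (-b) i
  rw [show -b + 1 = -(b - 1) by ring, shiftedProd_neg, shiftedProd_neg] at h
  linear_combination h

variable [CharZero K] (m : ℕ) (b₁ b₂ Z W : K)

/-- `tauAt` for the weights of `umemuraTau`. -/
def umemuraAt (x : K) : K :=
  tauAt (Icc 1 m) (fun i => shiftedProd b₁ i * Z ^ i) (fun j => shiftedProd b₂ j * W ^ j) x

/-- At this point the factor on I turns the weight for b₁ into that for b₁ + 1 times 1/2 + b₁ - i,
the same factor that the complement already carries. -/
theorem umemuraAt_half_add :
    umemuraAt m b₁ b₂ Z W (1 / 2 + b₁) =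
      (∏ i ∈ Icc 1 m, (1 / 2 + b₁ - (i : K))) * umemuraTau m (b₁ + 1) b₂ Z W := by
  rw [umemuraAt, tauAt, umemuraTau, ← tau_mul]
  refine tau_congr (fun i _ => ?_) fun i _ => by ring
  linear_combination (-Z ^ i) * shiftedProd_add_one b₁ i

theorem umemuraAt_half_sub :
    umemuraAt m b₁ b₂ Z W (1 / 2 - b₁) =
      (∏ i ∈ Icc 1 m, (1 / 2 - b₁ - (i : K))) * umemuraTau m (b₁ - 1) b₂ Z W := by
  rw [umemuraAt, tauAt, umemuraTau, ← tau_mul]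
  refine tau_congr (fun i _ => ?_) fun i _ => by ring
  linear_combination (-Z ^ i) * shiftedProd_sub_one b₁ i

/-- Here the complement's weights absorb the shift, now in b₂. -/
theorem umemuraAt_neg_half_sub :
    umemuraAt m b₁ b₂ Z W (-1 / 2 - b₂) =
      (∏ i ∈ Icc 1 m, ((i : K) - 1 / 2 - b₂)) * umemuraTau m b₁ (b₂ + 1) Z W := by
  rw [umemuraAt, tauAt, umemuraTau, ← tau_mul]
  refine tau_congr (fun i _ => by ring) fun i _ => ?_
  linear_combination (W ^ i) * shiftedProd_add_one b₂ i

theorem umemuraAt_neg_half_add :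
    umemuraAt m b₁ b₂ Z W (-1 / 2 + b₂) =
      (∏ i ∈ Icc 1 m, ((i : K) - 1 / 2 + b₂)) * umemuraTau m b₁ (b₂ - 1) Z W := by
  rw [umemuraAt, tauAt, umemuraTau, ← tau_mul]
  refine tau_congr (fun i _ => by ring) fun i _ => ?_
  linear_combination (W ^ i) * shiftedProd_sub_one b₂ i

theorem umemuraAt_reflection {i : ℕ} (hi : i ≤ m) :
    shiftedProd b₂ i * W ^ i * umemuraAt m b₁ b₂ Z W i =
      shiftedProd b₁ i * Z ^ i * umemuraAt m b₁ b₂ Z W (-i) := by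
  rcases Nat.eq_zero_or_pos i with rfl | hpos
  · simp [shiftedProd_zero]
  · exact tauAt_reflection (fun i => shiftedProd b₁ i * Z ^ i) (fun j => shiftedProd b₂ j * W ^ j)
      (mem_Icc.2 ⟨hpos, hi⟩)

theorem umemuraAt_top :
    umemuraAt m b₁ b₂ Z W m = (-1) ^ m * (shiftedProd b₁ m * Z ^ m) *
      (∏ k ∈ Icc 1 m, ((m : K) + k)) * umemuraTau (m - 1) b₁ b₂ Z W := by
  cases m with
  | zero => simp [umemuraAt, tauAt, tau_empty, shiftedProd_zero, umemuraTau_zero]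
  | succ n => exact tauAt_top _ _ n

theorem umemuraAt_neg_top :
    umemuraAt m b₁ b₂ Z W (-m) = (-1) ^ m * (shiftedProd b₂ m * W ^ m) *
      (∏ k ∈ Icc 1 m, ((m : K) + k)) * umemuraTau (m - 1) b₁ b₂ Z W := by
  cases m with
  | zero => simp [umemuraAt, tauAt, tau_empty, shiftedProd_zero, umemuraTau_zero]
  | succ n => exact tauAt_neg_top _ _ n

/-- The residual factor of the bilinear pencil attached to `umemuraTau`. -/
def umemuraFactor (x : K) : K :=
  pencilFactor m (fun i => shiftedProd b₁ i * Z ^ i) (fun j => shiftedProd b₂ j * W ^ j)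
    Z W (b₁ ^ 2) (b₂ ^ 2) x

theorem umemuraFactor_sub (x y : K) :
    umemuraFactor m b₁ b₂ Z W x - umemuraFactor m b₁ b₂ Z W y =
      (W - Z) * umemuraTau m b₁ b₂ Z W ^ 2 * (x - y) := by
  rw [umemuraFactor, umemuraFactor, pencilFactor, pencilFactor, umemuraTau, ← tauMoment_zero]
  ring

variable {b₁ b₂ Z W}

theorem umemuraAt_pencil (hb₁ : ∀ s : ℕ, (2 * (s : K) - 1) ^ 2 - 4 * b₁ ^ 2 ≠ 0)
    (hb₂ : ∀ s : ℕ, (2 * (s : K) - 1) ^ 2 - 4 * b₂ ^ 2 ≠ 0) (hZ : Z ≠ 0) (hW : W ≠ 0) (u : K) :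
    W * (u ^ 2 - b₂ ^ 2) *
        (umemuraAt m b₁ b₂ Z W (1 / 2 + u) * umemuraAt m b₁ b₂ Z W (1 / 2 - u)) -
      Z * (u ^ 2 - b₁ ^ 2) *
        (umemuraAt m b₁ b₂ Z W (-1 / 2 + u) * umemuraAt m b₁ b₂ Z W (-1 / 2 - u)) =
    (∏ i ∈ Icc 1 m, (((i : K) - 1 / 2) ^ 2 - u ^ 2)) * umemuraFactor m b₁ b₂ Z W (u ^ 2) := by
  refine tauAt_pencil (fun i hi => ?_) u
  obtain ⟨n, rfl⟩ : ∃ n, i = n + 1 := ⟨i - 1, by have := (mem_Icc.1 hi).1; omega⟩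
  have hle := (mem_Icc.1 hi).2
  have h1 := umemuraAt_reflection m b₁ b₂ Z W hle
  -- The root condition at i combines the reflections at i and i - 1. Consecutive weights differ by
  -- Z or W times 4((n + 1/2)² - b²), which produces the pencil's coefficients. For n = 0 the
  -- reflection is trivial.
  have h0 := umemuraAt_reflection m b₁ b₂ Z W (i := n) (by omega)
  have hne : shiftedProd b₁ n * Z ^ n * (shiftedProd b₂ n * W ^ n) ≠ 0 :=
    mul_ne_zero (mul_ne_zero (shiftedProd_ne_zero hb₁ n) (pow_ne_zero _ hZ))
      (mul_ne_zero (shiftedProd_ne_zero hb₂ n) (pow_ne_zero _ hW))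
  rw [shiftedProd_succ, shiftedProd_succ] at h1
  rw [show (1 : K) - ((n + 1 : ℕ) : K) = -n by push_cast; ring,
    show ((n + 1 : ℕ) : K) - 1 = n by push_cast; ring]
  refine mul_left_cancel₀ hne ?_
  change _ * (_ * (umemuraAt m b₁ b₂ Z W ((n + 1 : ℕ) : K) * umemuraAt m b₁ b₂ Z W (-n))) =
    _ * (_ * (umemuraAt m b₁ b₂ Z W (-((n + 1 : ℕ) : K)) * umemuraAt m b₁ b₂ Z W n))
  have hc : ((n + 1 : ℕ) : K) = n + 1 := by push_cast; ring
  generalize umemuraAt m b₁ b₂ Z W ((n + 1 : ℕ) : K) = P at *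
  generalize umemuraAt m b₁ b₂ Z W (-((n + 1 : ℕ) : K)) = P' at *
  rw [hc]
  linear_combination (1 / 4 : K) * (shiftedProd b₁ n * Z ^ n * umemuraAt m b₁ b₂ Z W (-n)) * h1 -
    Z * ((n + 1 / 2 : K) ^ 2 - b₁ ^ 2) * (shiftedProd b₁ n * Z ^ n) * P' * h0

variable (hb₁ : ∀ s : ℕ, (2 * (s : K) - 1) ^ 2 - 4 * b₁ ^ 2 ≠ 0)
  (hb₂ : ∀ s : ℕ, (2 * (s : K) - 1) ^ 2 - 4 * b₂ ^ 2 ≠ 0) (hZ : Z ≠ 0) (hW : W ≠ 0)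

include hb₁ hb₂ hZ hW

/-- At u = b₁ the Z-term of the pencil vanishes, and the product ∏((i - 1/2)² - b₁²) is common to
both sides. -/
theorem umemuraTau_shift_left :
    W * (b₁ ^ 2 - b₂ ^ 2) *
      (umemuraTau m (b₁ - 1) b₂ Z W * umemuraTau m (b₁ + 1) b₂ Z W) =
      umemuraFactor m b₁ b₂ Z W (b₁ ^ 2) := by
  have h := umemuraAt_pencil m hb₁ hb₂ hZ hW b₁
  have hprod : (∏ i ∈ Icc 1 m, (1 / 2 + b₁ - (i : K))) * (∏ i ∈ Icc 1 m, (1 / 2 - b₁ - (i : K))) =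
      ∏ i ∈ Icc 1 m, (((i : K) - 1 / 2) ^ 2 - b₁ ^ 2) := by
    rw [← prod_mul_distrib]
    exact prod_congr rfl fun i _ => by ring
  have hne : ∏ i ∈ Icc 1 m, (((i : K) - 1 / 2) ^ 2 - b₁ ^ 2) ≠ 0 :=
    prod_ne_zero_iff.2 fun i _ h0 => hb₁ i (by linear_combination 4 * h0)
  rw [umemuraAt_half_add, umemuraAt_half_sub] at h
  refine mul_left_cancel₀ hne ?_
  rw [← h, ← hprod]
  ring

theorem umemuraTau_shift_right :
    Z * (b₁ ^ 2 - b₂ ^ 2) *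
      (umemuraTau m b₁ (b₂ - 1) Z W * umemuraTau m b₁ (b₂ + 1) Z W) =
      umemuraFactor m b₁ b₂ Z W (b₂ ^ 2) := by
  have h := umemuraAt_pencil m hb₁ hb₂ hZ hW b₂
  have hprod : (∏ i ∈ Icc 1 m, ((i : K) - 1 / 2 - b₂)) * (∏ i ∈ Icc 1 m, ((i : K) - 1 / 2 + b₂)) =
      ∏ i ∈ Icc 1 m, (((i : K) - 1 / 2) ^ 2 - b₂ ^ 2) := by
    rw [← prod_mul_distrib]
    exact prod_congr rfl fun i _ => by ring
  have hne : ∏ i ∈ Icc 1 m, (((i : K) - 1 / 2) ^ 2 - b₂ ^ 2) ≠ 0 :=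
    prod_ne_zero_iff.2 fun i _ h0 => hb₂ i (by linear_combination 4 * h0)
  rw [umemuraAt_neg_half_add, umemuraAt_neg_half_sub] at h
  refine mul_left_cancel₀ hne ?_
  rw [← h, ← hprod]
  ring

/-- At u = m + 1/2 the arguments of `umemuraAt` are ±m and ±(m + 1): the former give the (m - 1)-st
polynomial, and the latter combine as in `prod_mul_tau_succ`. For m = 0 the truncated m - 1 is
harmless, both U_{-1} and U_0 being 1. -/
theorem umemuraTau_pred_mul_succ :
    umemuraTau (m - 1) b₁ b₂ Z W * umemuraTau (m + 1) b₁ b₂ Z W =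
      4 * umemuraFactor m b₁ b₂ Z W (((m : K) + 1 / 2) ^ 2) := by
  have h := umemuraAt_pencil m hb₁ hb₂ hZ hW ((m : K) + 1 / 2)
  have hs : (∏ k ∈ Icc 1 m, (((m + 1 : ℕ) : K) - k)) * umemuraTau (m + 1) b₁ b₂ Z W =
      shiftedProd b₂ (m + 1) * W ^ (m + 1) * umemuraAt m b₁ b₂ Z W ((m + 1 : ℕ) : K) -
      shiftedProd b₁ (m + 1) * Z ^ (m + 1) * umemuraAt m b₁ b₂ Z W (-((m + 1 : ℕ) : K)) :=
    prod_mul_tau_succ _ _ m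
  have hprod : ∏ i ∈ Icc 1 m, (((i : K) - 1 / 2) ^ 2 - ((m : K) + 1 / 2) ^ 2) =
      (-1) ^ m * (∏ k ∈ Icc 1 m, ((m : K) + k)) * ∏ k ∈ Icc 1 m, (((m + 1 : ℕ) : K) - k) := by
    have hm : (-1 : K) ^ m = ∏ _k ∈ Icc 1 m, (-1 : K) := by simp
    rw [hm, ← prod_mul_distrib, ← prod_mul_distrib]
    refine prod_congr rfl fun i _ => ?_
    push_cast
    ring
  have hne : ∏ i ∈ Icc 1 m, (((i : K) - 1 / 2) ^ 2 - ((m : K) + 1 / 2) ^ 2) ≠ 0 := by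
    refine prod_ne_zero_iff.2 fun i hi h0 => ?_
    have h1 : ((i : K) + m) * ((m + 1 : ℕ) - i) = 0 := by
      push_cast
      linear_combination -h0
    have hi := mem_Icc.1 hi
    rcases mul_eq_zero.1 h1 with h | h
    · rw [← Nat.cast_add, Nat.cast_eq_zero] at h
      omega
    · rw [sub_eq_zero, Nat.cast_inj] at h
      omega
  rw [show (1 : K) / 2 + (m + 1 / 2) = ((m + 1 : ℕ) : K) by push_cast; ring,
    show (1 : K) / 2 - (m + 1 / 2) = -(m : K) by ring,
    show (-1 : K) / 2 + (m + 1 / 2) = (m : K) by ring,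
    show (-1 : K) / 2 - (m + 1 / 2) = -((m + 1 : ℕ) : K) by push_cast; ring,
    umemuraAt_top, umemuraAt_neg_top] at h
  refine mul_left_cancel₀ hne ?_
  rw [mul_left_comm _ (4 : K), ← h, hprod]
  rw [shiftedProd_succ, shiftedProd_succ] at hs
  linear_combination ((-1) ^ m * (∏ k ∈ Icc 1 m, ((m : K) + k)) *
    umemuraTau (m - 1) b₁ b₂ Z W) * hs

end Umemura

/-! ### Transfer from fields to integral domains. -/

section Domain

variable {R : Type*} [CommRing R] [Algebra ℚ R]

/-- `tauMoment` for the weights of `umemuraTau`. -/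
def umemuraMoment (k m : ℕ) (b₁ b₂ Z W : R) : R :=
  tauMoment k (Icc 1 m) (fun i => shiftedProd b₁ i * Z ^ i) (fun j => shiftedProd b₂ j * W ^ j)

theorem umemuraMoment_zero (m : ℕ) (b₁ b₂ Z W : R) :
    umemuraMoment 0 m b₁ b₂ Z W = umemuraTau m b₁ b₂ Z W :=
  tauMoment_zero _ _ _

theorem map_umemuraMoment {L : Type*} [CommRing L] [Algebra ℚ L] (f : R →+* L) (k m : ℕ)
    (b₁ b₂ Z W : R) :
    f (umemuraMoment k m b₁ b₂ Z W) = umemuraMoment k m (f b₁) (f b₂) (f Z) (f W) := by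
  simp [umemuraMoment, tauMoment, map_sum, map_prod, RingHom.map_rat_algebraMap, map_shiftedProd,
    map_ofNat]

/-- The bilinear relations over a field into which the coefficients embed. -/
theorem umemuraTau_relations_of_injective {L : Type*} [Field L] [CharZero L] {f : R →+* L}
    (hf : Function.Injective f) (m : ℕ) {b₁ b₂ Z W : R}
    (hb₁ : ∀ s : ℕ, (2 * (s : R) - 1) ^ 2 - 4 * b₁ ^ 2 ≠ 0)
    (hb₂ : ∀ s : ℕ, (2 * (s : R) - 1) ^ 2 - 4 * b₂ ^ 2 ≠ 0) (hZ : Z ≠ 0) (hW : W ≠ 0) :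
    (umemuraTau (m - 1) b₁ b₂ Z W * umemuraTau (m + 1) b₁ b₂ Z W
        - 4 * W * (b₁ ^ 2 - b₂ ^ 2) *
          (umemuraTau m (b₁ - 1) b₂ Z W * umemuraTau m (b₁ + 1) b₂ Z W) =
      ((2 * (m : R) + 1) ^ 2 - 4 * b₁ ^ 2) * (W - Z) * umemuraTau m b₁ b₂ Z W ^ 2) ∧
    (umemuraTau (m - 1) b₁ b₂ Z W * umemuraTau (m + 1) b₁ b₂ Z W
        - 4 * Z * (b₁ ^ 2 - b₂ ^ 2) *
          (umemuraTau m b₁ (b₂ - 1) Z W * umemuraTau m b₁ (b₂ + 1) Z W) =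
      ((2 * (m : R) + 1) ^ 2 - 4 * b₂ ^ 2) * (W - Z) * umemuraTau m b₁ b₂ Z W ^ 2) ∧
    umemuraTau (m - 1) b₁ b₂ Z W * umemuraTau (m + 1) b₁ b₂ Z W =
      ((2 * (m : R) + 1) ^ 2 * (W - Z) - 4 * (W * b₂ ^ 2 - Z * b₁ ^ 2)
          - 4 * (W - Z) * ((∑ i ∈ Icc 1 m, i : ℕ) : R)) * umemuraTau m b₁ b₂ Z W ^ 2
        + 4 * (W - Z) * (umemuraTau m b₁ b₂ Z W * umemuraMoment 2 m b₁ b₂ Z W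
          - umemuraMoment 1 m b₁ b₂ Z W ^ 2)
        - 4 * (W + Z) * (umemuraTau m b₁ b₂ Z W * umemuraMoment 1 m b₁ b₂ Z W) := by
  have hb₁' : ∀ s : ℕ, (2 * (s : L) - 1) ^ 2 - 4 * f b₁ ^ 2 ≠ 0 := fun s h =>
    hb₁ s (hf (by simpa [map_ofNat] using h))
  have hb₂' : ∀ s : ℕ, (2 * (s : L) - 1) ^ 2 - 4 * f b₂ ^ 2 ≠ 0 := fun s h =>
    hb₂ s (hf (by simpa [map_ofNat] using h))
  have hZ' : f Z ≠ 0 := fun h => hZ (hf (by simpa using h))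
  have hW' : f W ≠ 0 := fun h => hW (hf (by simpa using h))
  have h1 := umemuraTau_shift_left m hb₁' hb₂' hZ' hW'
  have h2 := umemuraTau_shift_right m hb₁' hb₂' hZ' hW'
  have h3 := umemuraTau_pred_mul_succ m hb₁' hb₂' hZ' hW'
  have d1 := umemuraFactor_sub m (f b₁) (f b₂) (f Z) (f W) (((m : L) + 1 / 2) ^ 2) (f b₁ ^ 2)
  have d2 := umemuraFactor_sub m (f b₁) (f b₂) (f Z) (f W) (((m : L) + 1 / 2) ^ 2) (f b₂ ^ 2)
  refine ⟨hf ?_, hf ?_, hf ?_⟩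
  · simp only [map_sub, map_add, map_mul, map_pow, map_umemuraTau, map_one, map_ofNat,
      map_natCast]
    linear_combination h3 - 4 * h1 + 4 * d1
  · simp only [map_sub, map_add, map_mul, map_pow, map_umemuraTau, map_one, map_ofNat,
      map_natCast]
    linear_combination h3 - 4 * h2 + 4 * d2
  · simp only [map_sub, map_add, map_mul, map_pow, map_umemuraTau, map_umemuraMoment, map_one,
      map_ofNat, map_natCast]
    rw [h3, umemuraFactor, pencilFactor, tauMoment_zero]
    unfold umemuraTau umemuraMoment
    ring

theorem umemuraTau_relations [IsDomain R] (m : ℕ) {b₁ b₂ Z W : R}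
    (hb₁ : ∀ s : ℕ, (2 * (s : R) - 1) ^ 2 - 4 * b₁ ^ 2 ≠ 0)
    (hb₂ : ∀ s : ℕ, (2 * (s : R) - 1) ^ 2 - 4 * b₂ ^ 2 ≠ 0) (hZ : Z ≠ 0) (hW : W ≠ 0) :
    (umemuraTau (m - 1) b₁ b₂ Z W * umemuraTau (m + 1) b₁ b₂ Z W
        - 4 * W * (b₁ ^ 2 - b₂ ^ 2) *
          (umemuraTau m (b₁ - 1) b₂ Z W * umemuraTau m (b₁ + 1) b₂ Z W) =
      ((2 * (m : R) + 1) ^ 2 - 4 * b₁ ^ 2) * (W - Z) * umemuraTau m b₁ b₂ Z W ^ 2) ∧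
    (umemuraTau (m - 1) b₁ b₂ Z W * umemuraTau (m + 1) b₁ b₂ Z W
        - 4 * Z * (b₁ ^ 2 - b₂ ^ 2) *
          (umemuraTau m b₁ (b₂ - 1) Z W * umemuraTau m b₁ (b₂ + 1) Z W) =
      ((2 * (m : R) + 1) ^ 2 - 4 * b₂ ^ 2) * (W - Z) * umemuraTau m b₁ b₂ Z W ^ 2) ∧
    umemuraTau (m - 1) b₁ b₂ Z W * umemuraTau (m + 1) b₁ b₂ Z W =
      ((2 * (m : R) + 1) ^ 2 * (W - Z) - 4 * (W * b₂ ^ 2 - Z * b₁ ^ 2)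
          - 4 * (W - Z) * ((∑ i ∈ Icc 1 m, i : ℕ) : R)) * umemuraTau m b₁ b₂ Z W ^ 2
        + 4 * (W - Z) * (umemuraTau m b₁ b₂ Z W * umemuraMoment 2 m b₁ b₂ Z W
          - umemuraMoment 1 m b₁ b₂ Z W ^ 2)
        - 4 * (W + Z) * (umemuraTau m b₁ b₂ Z W * umemuraMoment 1 m b₁ b₂ Z W) := by
  have hinj := IsFractionRing.injective R (FractionRing R)
  have : CharZero R := algebraRat.charZero R
  have : CharZero (FractionRing R) := charZero_of_injective_algebraMap hinj
  exact umemuraTau_relations_of_injective hinj m hb₁ hb₂ hZ hW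

end Domain

/-! ### The polynomial ring in b₁, b₂, v and the Toda recurrence. -/

namespace ParamPoly

/-- The constant `1 / 4`. -/
def quarter : ParamPoly := algebraMap ℚ ParamPoly (1 / 4)

theorem four_mul_quarter : 4 * quarter = 1 := by
  rw [quarter, ← map_ofNat (algebraMap ℚ ParamPoly) 4, ← map_mul]
  norm_num

/-- `z ^ 2` as a polynomial in `v = 2 + 4 z ^ 2`. -/
def zSq : ParamPoly := quarter * (X - 2)

/-- `w ^ 2` as a polynomial in `v = 2 + 4 z ^ 2`, where `w ^ 2 = 1 + z ^ 2`. -/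
def wSq : ParamPoly := quarter * (X + 2)

theorem four_mul_zSq : 4 * zSq = X - 2 := by
  rw [zSq, ← mul_assoc, four_mul_quarter, one_mul]

theorem four_mul_wSq : 4 * wSq = X + 2 := by
  rw [wSq, ← mul_assoc, four_mul_quarter, one_mul]

/-- `ParamPoly.value` as a ring homomorphism. -/
def valueHom (b₁ b₂ v : ℂ) : ParamPoly →+* ℂ :=
  eval₂RingHom (MvPolynomial.aeval (R := ℚ) ![b₁, b₂]).toRingHom v

theorem valueHom_apply (b₁ b₂ v : ℂ) (T : ParamPoly) : valueHom b₁ b₂ v T = T.value b₁ b₂ v := rfl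

theorem valueHom_b₁ (x y v : ℂ) : valueHom x y v b₁ = x := by
  simp [valueHom, b₁]

theorem valueHom_b₂ (x y v : ℂ) : valueHom x y v b₂ = y := by
  simp [valueHom, b₂]

theorem valueHom_X (x y v : ℂ) : valueHom x y v X = v := by
  simp [valueHom]

theorem valueHom_zSq (x y z : ℂ) : valueHom x y (2 + 4 * z ^ 2) zSq = z ^ 2 := by
  have h := congrArg (valueHom x y (2 + 4 * z ^ 2)) four_mul_zSq
  simp only [map_mul, map_sub, map_ofNat, valueHom_X] at h
  linear_combination h / 4

theorem valueHom_wSq (x y z : ℂ) : valueHom x y (2 + 4 * z ^ 2) wSq = z ^ 2 + 1 := by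
  have h := congrArg (valueHom x y (2 + 4 * z ^ 2)) four_mul_wSq
  simp only [map_mul, map_add, map_ofNat, valueHom_X] at h
  linear_combination h / 4

theorem odd_sq_ne_zero (s : ℕ) : (2 * (s : ℂ) - 1) ^ 2 ≠ 0 := by
  refine pow_ne_zero _ fun h => ?_
  have h2 : (((2 * s : ℕ)) : ℂ) = ((1 : ℕ) : ℂ) := by
    push_cast
    linear_combination h
  have := Nat.cast_injective h2
  omega

/-- Setting the indeterminates to zero leaves the square of an odd integer. -/
theorem odd_sq_sub_ne_zero {b : ParamPoly} (hb : valueHom 0 0 0 b = 0) (s : ℕ) :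
    (2 * (s : ParamPoly) - 1) ^ 2 - 4 * b ^ 2 ≠ 0 := by
  intro h
  have h := congrArg (valueHom 0 0 0) h
  simp only [map_sub, map_mul, map_pow, map_ofNat, map_natCast, map_one, hb, map_zero] at h
  exact odd_sq_ne_zero s (by linear_combination h)

theorem zSq_ne_zero : zSq ≠ 0 := by
  intro h
  have := valueHom_zSq 0 0 1
  rw [h, map_zero] at this
  norm_num at this

theorem wSq_ne_zero : wSq ≠ 0 := by
  intro h
  have := valueHom_wSq 0 0 0
  rw [h, map_zero] at this
  norm_num at this

theorem wSq_sub_zSq : wSq - zSq = 1 := by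
  rw [← four_mul_quarter, wSq, zSq]
  ring

theorem b₁_sq_sub_b₂_sq_ne_zero : b₁ ^ 2 - b₂ ^ 2 ≠ 0 := by
  intro h
  have := congrArg (valueHom 1 0 0) h
  simp [valueHom_b₁, valueHom_b₂] at this

theorem derivative_quarter : derivative quarter = 0 := by
  rw [quarter, Polynomial.algebraMap_apply, derivative_C]

theorem derivative_zSq : derivative zSq = quarter := by
  simp [zSq, derivative_quarter]

theorem derivative_wSq : derivative wSq = quarter := by
  simp [wSq, derivative_quarter]

theorem mul_derivative_pow (f : ParamPoly) (p : ℕ) :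
    f * derivative (f ^ p) = p * f ^ p * derivative f := by
  cases p with
  | zero => simp
  | succ n =>
    rw [derivative_pow_succ, pow_succ]
    push_cast
    simp only [map_add, map_natCast, map_one]
    ring

/-- Since v² - 4 = 16ZW and Z' = W' = 1/4, the left side is 4(pW + qZ)Z^pW^q, with 4W = v + 2 and 4Z
= v - 2. -/
theorem sq_sub_four_mul_derivative_pow_mul_pow (p q : ℕ) :
    (X ^ 2 - 4) * derivative (zSq ^ p * wSq ^ q) =
      (2 * ((p : ParamPoly) - (q : ParamPoly)) + ((p : ParamPoly) + (q : ParamPoly)) * X) * (zSq ^ p * wSq ^ q) := by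
  have hz := mul_derivative_pow zSq p
  have hw := mul_derivative_pow wSq q
  rw [derivative_zSq] at hz
  rw [derivative_wSq] at hw
  have h : (X ^ 2 - 4 : ParamPoly) = 16 * (zSq * wSq) := by
    linear_combination (-(X + 2)) * four_mul_zSq - 4 * zSq * four_mul_wSq
  rw [h, derivative_mul]
  linear_combination 16 * wSq * wSq ^ q * hz + 16 * zSq * zSq ^ p * hw +
    4 * (p * wSq + q * zSq) * zSq ^ p * wSq ^ q * four_mul_quarter +
    p * (zSq ^ p * wSq ^ q) * four_mul_wSq + q * (zSq ^ p * wSq ^ q) * four_mul_zSq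

theorem prod_shiftedProd_mul_pow (I : Finset ℕ) (c : MvPolynomial (Fin 2) ℚ) (Y : ParamPoly) :
    ∏ i ∈ I, shiftedProd (C c) i * Y ^ i = C (∏ i ∈ I, shiftedProd c i) * Y ^ (∑ i ∈ I, i) := by
  rw [prod_mul_distrib, prod_pow_eq_pow_sum, map_prod]
  simp only [map_shiftedProd]

/-- The term of I is a constant times Z^p W^q with p = ∑I and q = ∑(S \ I). Thus p - q is the
statistic 2∑I - ∑S, while p + q does not depend on I. -/
theorem sq_sub_four_mul_derivative_moment (k m : ℕ) :
    (X ^ 2 - 4) * derivative (umemuraMoment k m b₁ b₂ zSq wSq) =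
      2 * umemuraMoment (k + 1) m b₁ b₂ zSq wSq +
        ((∑ i ∈ Icc 1 m, i : ℕ) : ParamPoly) * X * umemuraMoment k m b₁ b₂ zSq wSq := by
  simp only [umemuraMoment, tauMoment, derivative_sum, mul_sum, ← sum_add_distrib]
  refine sum_congr rfl fun I hI => ?_
  have hsum : ((∑ i ∈ Icc 1 m, i : ℕ) : ParamPoly) =
      ((∑ i ∈ I, i : ℕ) : ParamPoly) + ((∑ i ∈ Icc 1 m \ I, i : ℕ) : ParamPoly) := by
    rw [← Nat.cast_add, ← sum_sdiff (mem_powerset.1 hI), add_comm]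
  rw [b₁, b₂, prod_shiftedProd_mul_pow, prod_shiftedProd_mul_pow, hsum]
  generalize ∑ i ∈ I, i = p
  generalize ∑ i ∈ Icc 1 m \ I, i = q
  generalize ∏ i ∈ I, shiftedProd (MvPolynomial.X (R := ℚ) (0 : Fin 2)) i = c₁
  generalize ∏ i ∈ Icc 1 m \ I, shiftedProd (MvPolynomial.X (R := ℚ) (1 : Fin 2)) i = c₂
  have hterm : ∀ l : ℕ, algebraMap ℚ ParamPoly (crossWeight (Icc 1 m) I) *
      (C c₁ * zSq ^ p * (C c₂ * wSq ^ q)) * (2 * (p : ParamPoly) - (p + q)) ^ l =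
      C (algebraMap ℚ _ (crossWeight (Icc 1 m) I) * c₁ * c₂ *
        (2 * (p : MvPolynomial (Fin 2) ℚ) - (p + q)) ^ l) * (zSq ^ p * wSq ^ q) := by
    intro l
    simp only [Polynomial.algebraMap_apply, map_mul, map_pow, map_sub, map_add, map_natCast,
      map_ofNat]
    ring
  have h := sq_sub_four_mul_derivative_pow_mul_pow p q
  rw [hterm k, hterm (k + 1), derivative_C_mul, pow_succ]
  simp only [map_mul, map_pow, map_sub, map_add, map_natCast, map_ofNat]
  linear_combination C (algebraMap ℚ _ (crossWeight (Icc 1 m) I)) * C c₁ * C c₂ *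
    (2 * (p : ParamPoly) - (p + q)) ^ k * h

/-- Umemura's polynomial, up to a power of two, as a polynomial in `b₁, b₂, v`. -/
def umemura (m : ℕ) : ParamPoly := umemuraTau m b₁ b₂ zSq wSq

theorem umemura_toda (m : ℕ) :
    umemura (m - 1) * umemura (m + 1) =
      ((2 * (m : ParamPoly) + 1) ^ 2 + (-2 * b₁ ^ 2 - 2 * b₂ ^ 2 + (b₁ ^ 2 - b₂ ^ 2) * X)) *
          umemura m ^ 2 +
        (X ^ 2 - 4) ^ 2 * (umemura m * derivative (derivative (umemura m)) -
          derivative (umemura m) ^ 2) +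
        (X ^ 2 - 4) * X * (umemura m * derivative (umemura m)) := by
  obtain ⟨-, -, h⟩ := umemuraTau_relations m (odd_sq_sub_ne_zero (valueHom_b₁ 0 0 0))
    (odd_sq_sub_ne_zero (valueHom_b₂ 0 0 0)) zSq_ne_zero wSq_ne_zero
  have d0 := sq_sub_four_mul_derivative_moment 0 m
  have d1 := sq_sub_four_mul_derivative_moment 1 m
  have hsum : 4 * (wSq + zSq) = 2 * X := by
    linear_combination four_mul_wSq + four_mul_zSq
  rw [wSq_sub_zSq, hsum] at h
  rw [umemuraMoment_zero] at d0
  simp only [← show ∀ k, umemura k = umemuraTau k b₁ b₂ zSq wSq from fun _ => rfl] at h d0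
  generalize umemuraMoment 1 m b₁ b₂ zSq wSq = U₁ at *
  generalize umemuraMoment 2 m b₁ b₂ zSq wSq = U₂ at *
  generalize (∑ i ∈ Icc 1 m, i) = M at *
  -- Differentiating d0 brings in the second derivative of the polynomial; d1 then trades the
  -- derivative of the first moment for the second moment.
  have dd0 := congrArg derivative d0
  simp only [derivative_mul, derivative_add, derivative_sub, derivative_X_pow, derivative_X,
    derivative_ofNat, derivative_natCast, map_ofNat, Nat.cast_ofNat] at dd0
  linear_combination h - umemura m * (X ^ 2 - 4) * dd0 - 2 * umemura m * d1 -
    (((M : ParamPoly) * X - X) * umemura m - (X ^ 2 - 4) * derivative (umemura m) -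
      (2 * U₁ + (M : ParamPoly) * X * umemura m)) * d0 -
    b₂ ^ 2 * umemura m ^ 2 * four_mul_wSq + b₁ ^ 2 * umemura m ^ 2 * four_mul_zSq

end ParamPoly

/-! ### Existence and uniqueness of the Toda sequence. -/

namespace ParamPoly

theorem umemura_ne_zero (m : ℕ) : umemura m ≠ 0 := by
  intro h
  -- At b₁ = b₂ = 0, v = 2 one has Z = 0 and W = 1, so only I = ∅ survives and the value is a
  -- product of odd squares.
  have h := congrArg (valueHom 0 0 (2 + 4 * 0 ^ 2)) h
  rw [map_zero, umemura, map_umemuraTau, valueHom_b₁, valueHom_b₂, valueHom_zSq, valueHom_wSq,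
    umemuraTau, tau_of_left_eq_zero] at h
  · refine prod_ne_zero_iff.2 (fun j _ => ?_) h
    refine mul_ne_zero (shiftedProd_ne_zero (fun s h0 => ?_) j) (by norm_num)
    exact odd_sq_ne_zero s (by linear_combination h0)
  · intro i hi
    have : i ≠ 0 := by have := (mem_Icc.1 hi).1; omega
    simp [this]

/-- The candidate for the sequence `T_n`. -/
def umemuraSeq (n : ℕ) : ParamPoly := ((2 : ℚ) ^ (n * (n - 1)))⁻¹ • umemura (n - 1)

theorem umemuraSeq_ne_zero (n : ℕ) : umemuraSeq n ≠ 0 :=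
  smul_ne_zero (inv_ne_zero (by positivity)) (umemura_ne_zero _)

theorem isUmemuraSequence_umemuraSeq : IsUmemuraSequence umemuraSeq where
  zero := by simp [umemuraSeq, umemura, umemuraTau_zero]
  one := by simp [umemuraSeq, umemura, umemuraTau_zero]
  toda n hn := by
    obtain ⟨m, rfl⟩ : ∃ m, n = m + 1 := ⟨n - 1, by omega⟩
    have h := umemura_toda m
    -- The exponents n(n - 1) have second difference 2, which supplies the factor 1/4 in the
    -- recurrence.
    have hc : ((2 : ℚ) ^ (m * (m - 1)))⁻¹ * ((2 : ℚ) ^ ((m + 1 + 1) * (m + 1)))⁻¹ =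
        1 / 4 * (((2 : ℚ) ^ ((m + 1) * m))⁻¹) ^ 2 := by
      have he : m * (m - 1) + (m + 1 + 1) * (m + 1) = 2 + ((m + 1) * m + (m + 1) * m) := by
        cases m with
        | zero => rfl
        | succ k => rw [Nat.add_sub_cancel]; ring
      rw [← mul_inv, ← pow_add, he, pow_add, pow_add, mul_inv, mul_inv]
      norm_num [sq]
    simp only [umemuraSeq, Nat.add_sub_cancel, derivative_smul]
    generalize ((2 : ℚ) ^ (m * (m - 1)))⁻¹ = r₀ at *
    generalize ((2 : ℚ) ^ ((m + 1 + 1) * (m + 1)))⁻¹ = r₂ at *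
    generalize ((2 : ℚ) ^ ((m + 1) * m))⁻¹ = r₁ at *
    have hc := congrArg (algebraMap ℚ ParamPoly) hc
    have hn : (((m + 1 : ℕ) : ℚ) - 1 / 2) ^ 2 = (1 / 4) * (2 * m + 1) ^ 2 := by
      push_cast
      ring
    rw [hn]
    simp only [Algebra.smul_def, map_mul, map_pow, map_add, map_one, map_natCast, map_ofNat]
      at hc ⊢
    rw [← quarter] at *
    linear_combination (umemura (m - 1) * umemura (m + 1)) * hc +
      quarter * algebraMap ℚ ParamPoly r₁ ^ 2 * h

theorem eq_umemuraSeq {T : ℕ → ParamPoly} (hT : IsUmemuraSequence T) : T = umemuraSeq := by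
  have hS := isUmemuraSequence_umemuraSeq
  have key : ∀ n, T n = umemuraSeq n ∧ T (n + 1) = umemuraSeq (n + 1) := by
    intro n
    induction n with
    | zero => exact ⟨hT.zero.trans hS.zero.symm, hT.one.trans hS.one.symm⟩
    | succ n ih =>
      refine ⟨ih.2, mul_left_cancel₀ (umemuraSeq_ne_zero n) ?_⟩
      have h1 := hT.toda (n + 1) (by omega)
      have h2 := hS.toda (n + 1) (by omega)
      rw [Nat.add_sub_cancel, ih.1, ih.2] at h1
      rw [Nat.add_sub_cancel] at h2
      exact h1.trans h2.symm
  exact funext fun n => (key n).1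

end ParamPoly

/-! ### Evaluation at complex parameters. -/

open ParamPoly

theorem aEven_eq_shiftedProd (b : ℂ) (i : ℕ) : aEven (-4 * b ^ 2) i = shiftedProd b i := by
  refine prod_congr rfl fun s _ => ?_
  rw [abar]
  push_cast
  ring

theorem umemuraU_eq_umemuraTau (m : ℤ) (b₁ b₂ z w : ℂ) :
    umemuraU m b₁ b₂ z w = umemuraTau m.toNat b₁ b₂ (z ^ 2) (w ^ 2) := by
  rw [umemuraU, genUmemura, umemuraTau, tau]
  refine sum_congr rfl fun I _ => ?_
  simp only [aEven_eq_shiftedProd, prod_mul_distrib, ← pow_mul, prod_pow_eq_pow_sum,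
    crossWeight, map_mul, map_pow, map_neg, map_one, eq_ratCast, dNum, halfIndex]
  ring

theorem umemuraU_eq_valueHom (m : ℤ) (b₁ b₂ : ℂ) {z w : ℂ} (h : w ^ 2 - z ^ 2 = 1)
    (x y : ℂ) (f g : ParamPoly) (hf : valueHom x y (2 + 4 * z ^ 2) f = b₁)
    (hg : valueHom x y (2 + 4 * z ^ 2) g = b₂) :
    umemuraU m b₁ b₂ z w = valueHom x y (2 + 4 * z ^ 2) (umemuraTau m.toNat f g zSq wSq) := by
  rw [umemuraU_eq_umemuraTau, map_umemuraTau, hf, hg, valueHom_zSq, valueHom_wSq,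
    show w ^ 2 = z ^ 2 + 1 by linear_combination h]

theorem umemuraU_relations (m : ℕ) (b₁ b₂ z w : ℂ) (h : w ^ 2 - z ^ 2 = 1) :
    (umemuraU ((m : ℤ) - 1) b₁ b₂ z w * umemuraU (m + 1) b₁ b₂ z w
          - 4 * w ^ 2 * (b₁ ^ 2 - b₂ ^ 2) *
            (umemuraU m (b₁ - 1) b₂ z w * umemuraU m (b₁ + 1) b₂ z w)
        = abar (-4 * b₁ ^ 2) (2 * m + 2) * umemuraU m b₁ b₂ z w ^ 2) ∧
      (umemuraU ((m : ℤ) - 1) b₁ b₂ z w * umemuraU (m + 1) b₁ b₂ z w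
          - 4 * z ^ 2 * (b₁ ^ 2 - b₂ ^ 2) *
            (umemuraU m b₁ (b₂ - 1) z w * umemuraU m b₁ (b₂ + 1) z w)
        = abar (-4 * b₂ ^ 2) (2 * m + 2) * umemuraU m b₁ b₂ z w ^ 2) ∧
      (umemuraU ((m : ℤ) - 1) b₁ b₂ z w * umemuraU (m + 1) b₁ b₂ z w
          - abar (-4 * b₂ ^ 2) (2 * m + 2) * w ^ 2 *
            (umemuraU m (b₁ - 1) b₂ z w * umemuraU m (b₁ + 1) b₂ z w)
          + abar (-4 * b₁ ^ 2) (2 * m + 2) * z ^ 2 *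
            (umemuraU m b₁ (b₂ - 1) z w * umemuraU m b₁ (b₂ + 1) z w)
        = 0) := by
  obtain ⟨h1, h2, -⟩ := umemuraTau_relations m (odd_sq_sub_ne_zero (valueHom_b₁ 0 0 0))
    (odd_sq_sub_ne_zero (valueHom_b₂ 0 0 0)) zSq_ne_zero wSq_ne_zero
  rw [wSq_sub_zSq, mul_one] at h1 h2
  have h3 : umemuraTau (m - 1) ParamPoly.b₁ ParamPoly.b₂ zSq wSq *
        umemuraTau (m + 1) ParamPoly.b₁ ParamPoly.b₂ zSq wSq
      - ((2 * (m : ParamPoly) + 1) ^ 2 - 4 * ParamPoly.b₂ ^ 2) * wSq *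
        (umemuraTau m (ParamPoly.b₁ - 1) ParamPoly.b₂ zSq wSq *
          umemuraTau m (ParamPoly.b₁ + 1) ParamPoly.b₂ zSq wSq)
      + ((2 * (m : ParamPoly) + 1) ^ 2 - 4 * ParamPoly.b₁ ^ 2) * zSq *
        (umemuraTau m ParamPoly.b₁ (ParamPoly.b₂ - 1) zSq wSq *
          umemuraTau m ParamPoly.b₁ (ParamPoly.b₂ + 1) zSq wSq) = 0 := by
    -- Cancelling b₁² - b₂² requires indeterminates; after evaluation the third relation also covers
    -- b₁² = b₂².
    have hne : (4 : ParamPoly) * (ParamPoly.b₁ ^ 2 - ParamPoly.b₂ ^ 2) ≠ 0 :=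
      mul_ne_zero (fun h4 => by simpa [h4] using four_mul_quarter) b₁_sq_sub_b₂_sq_ne_zero
    refine mul_left_cancel₀ hne ?_
    linear_combination ((2 * (m : ParamPoly) + 1) ^ 2 - 4 * ParamPoly.b₂ ^ 2) * h1 -
      ((2 * (m : ParamPoly) + 1) ^ 2 - 4 * ParamPoly.b₁ ^ 2) * h2
  have hb₁ := valueHom_b₁ b₁ b₂ (2 + 4 * z ^ 2)
  have hb₂ := valueHom_b₂ b₁ b₂ (2 + 4 * z ^ 2)
  -- The shifted polynomials too are evaluated at the unshifted point (b₁, b₂), the shift being made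
  -- inside the polynomial ring, so one homomorphism carries each identity.
  have e := fun (k : ℤ) => umemuraU_eq_valueHom k b₁ b₂ h b₁ b₂ _ _ hb₁ hb₂
  have e₁ := fun (k : ℤ) => umemuraU_eq_valueHom k (b₁ - 1) b₂ h b₁ b₂ (ParamPoly.b₁ - 1) _
    (by rw [map_sub, hb₁, map_one]) hb₂
  have e₂ := fun (k : ℤ) => umemuraU_eq_valueHom k (b₁ + 1) b₂ h b₁ b₂ (ParamPoly.b₁ + 1) _
    (by rw [map_add, hb₁, map_one]) hb₂
  have e₃ := fun (k : ℤ) => umemuraU_eq_valueHom k b₁ (b₂ - 1) h b₁ b₂ _ (ParamPoly.b₂ - 1)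
    hb₁ (by rw [map_sub, hb₂, map_one])
  have e₄ := fun (k : ℤ) => umemuraU_eq_valueHom k b₁ (b₂ + 1) h b₁ b₂ _ (ParamPoly.b₂ + 1)
    hb₁ (by rw [map_add, hb₂, map_one])
  have hw : valueHom b₁ b₂ (2 + 4 * z ^ 2) wSq = w ^ 2 := by
    rw [valueHom_wSq]
    linear_combination -h
  have ha : ∀ b : ℂ, abar (-4 * b ^ 2) (2 * m + 2) = (2 * (m : ℂ) + 1) ^ 2 - 4 * b ^ 2 := by
    intro b
    rw [abar]
    push_cast
    ring
  rw [e, e, e, e₁, e₂, e₃, e₄, ha, ha, show ((m : ℤ) - 1).toNat = m - 1 by omega,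
    show ((m : ℤ) + 1).toNat = m + 1 by omega, Int.toNat_natCast]
  refine ⟨?_, ?_, ?_⟩
  · have := congrArg (valueHom b₁ b₂ (2 + 4 * z ^ 2)) h1
    simpa only [map_sub, map_add, map_mul, map_pow, map_one, map_ofNat, map_natCast, hb₁, hb₂,
      hw, valueHom_zSq] using this
  · have := congrArg (valueHom b₁ b₂ (2 + 4 * z ^ 2)) h2
    simpa only [map_sub, map_add, map_mul, map_pow, map_one, map_ofNat, map_natCast, hb₁, hb₂,
      hw, valueHom_zSq] using this
  · have := congrArg (valueHom b₁ b₂ (2 + 4 * z ^ 2)) h3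
    simpa only [map_sub, map_add, map_mul, map_pow, map_one, map_ofNat, map_natCast, hb₁, hb₂,
      hw, valueHom_zSq, map_zero] using this

theorem umemuraU_eq_umemuraSeq_value (n : ℕ) (b₁ b₂ z w : ℂ) (h : w ^ 2 - z ^ 2 = 1) :
    umemuraU ((n : ℤ) - 1) b₁ b₂ z w =
      2 ^ (n * (n - 1)) * (umemuraSeq n).value b₁ b₂ (2 + 4 * z ^ 2) := by
  rw [umemuraU_eq_valueHom _ b₁ b₂ h b₁ b₂ _ _ (valueHom_b₁ _ _ _) (valueHom_b₂ _ _ _),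
    ← valueHom_apply, umemuraSeq, umemura, Algebra.smul_def, map_mul,
    RingHom.map_rat_algebraMap, show ((n : ℤ) - 1).toNat = n - 1 by omega, ← mul_assoc, map_inv₀,
    map_pow, map_ofNat, mul_inv_cancel₀ (pow_ne_zero _ two_ne_zero), one_mul]

end

theorem corollary2 :
    -- The polynomials `U_m` are Umemura's: `U_{n-1} = 2^{n(n-1)} T_n(v)` with `v = 2 + 4 z^2`.
    (∃! T : ℕ → ParamPoly, IsUmemuraSequence T) ∧
    (∀ T : ℕ → ParamPoly, IsUmemuraSequence T →
      ∀ (n : ℕ) (b₁ b₂ z w : ℂ), w ^ 2 - z ^ 2 = 1 →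
        umemuraU ((n : ℤ) - 1) b₁ b₂ z w =
          2 ^ (n * (n - 1)) * (T n).value b₁ b₂ (2 + 4 * z ^ 2)) ∧
    -- The three bilinear relations.
    (∀ (m : ℤ), 0 ≤ m → ∀ (b₁ b₂ z w : ℂ), w ^ 2 - z ^ 2 = 1 →
      (umemuraU (m - 1) b₁ b₂ z w * umemuraU (m + 1) b₁ b₂ z w
          - 4 * w ^ 2 * (b₁ ^ 2 - b₂ ^ 2) *
            (umemuraU m (b₁ - 1) b₂ z w * umemuraU m (b₁ + 1) b₂ z w)
        = abar (-4 * b₁ ^ 2) (2 * m + 2) * umemuraU m b₁ b₂ z w ^ 2) ∧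
      (umemuraU (m - 1) b₁ b₂ z w * umemuraU (m + 1) b₁ b₂ z w
          - 4 * z ^ 2 * (b₁ ^ 2 - b₂ ^ 2) *
            (umemuraU m b₁ (b₂ - 1) z w * umemuraU m b₁ (b₂ + 1) z w)
        = abar (-4 * b₂ ^ 2) (2 * m + 2) * umemuraU m b₁ b₂ z w ^ 2) ∧
      (umemuraU (m - 1) b₁ b₂ z w * umemuraU (m + 1) b₁ b₂ z w
          - abar (-4 * b₂ ^ 2) (2 * m + 2) * w ^ 2 *
            (umemuraU m (b₁ - 1) b₂ z w * umemuraU m (b₁ + 1) b₂ z w)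
          + abar (-4 * b₁ ^ 2) (2 * m + 2) * z ^ 2 *
            (umemuraU m b₁ (b₂ - 1) z w * umemuraU m b₁ (b₂ + 1) z w)
        = 0)) := by
  refine ⟨⟨ParamPoly.umemuraSeq, ParamPoly.isUmemuraSequence_umemuraSeq,
    fun T hT => ParamPoly.eq_umemuraSeq hT⟩, ?_, ?_⟩
  · intro T hT n b₁ b₂ z w h
    rw [ParamPoly.eq_umemuraSeq hT]
    exact umemuraU_eq_umemuraSeq_value n b₁ b₂ z w h
  · intro m hm b₁ b₂ z w h
    lift m to ℕ using hm
    exact umemuraU_relations m b₁ b₂ z w h
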